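/- Let $d_v,d_c\ge 1$ and $\ell\ge 0$ be integers. **Setting.** Let the positive integers $n,m$ satisfy $m d_c=n d_v$. Draw a graph uniformly among all simple bipartite graphs with $n$ labelled variable nodes, each adjacent to exactly $d_v$ check nodes, and $m$ labelled check nodes, each adjacent to exactly $d_c$ variable nodes (assume that such graphs exist). Give its edges i.i.d. weights $w_{vc}$ with law $f$, and draw a signal $x\in\mathbb R^n$ with i.i.d. entries, each being $0$ with probability $1-\alpha$ and distributed according to $g$ with probability $\alpha$, where $\alpha\in[0,1]$; graph, weights and signal are independent. The measurement at a check node $c$ is $y_c=\sum_{v\sim c}w_{vc}x_v$. **Algorithms.** A variable node sends to all its neighbours the same message $(s_v,u_v)\in\{0,1\}\times\mathbb R$ (status and verified value), initially $(0,0)$. In a *round*, each check node $c$ computes the number $d$ of its neighbours with $s_v=0$ and the residual $r_c=y_c-\sum_{v\sim c}s_v w_{vc}u_v$, and sends $(d,r_c/w_{vc})$ to each neighbour $v$; then each $v$ with $s_v=1$ keeps its message, and each $v$ with $s_v=0$ updates it by the rules of the round, keeping $(0,0)$ if none applies. Each iteration consists of two rounds. First round: if some incoming message is $(1,a)$, the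 new message is $(1,a)$ (degree-one rule); otherwise, for the algorithm SBB only, if the messages from two distinct check nodes have the same second coordinate $a$, the new message is $(1,a)$ (equal-check rule). Second round: if some incoming message has second coordinate $0$, the new message is $(1,0)$ (zero-check rule). If several values $a$ qualify for the rule that is applied, the smallest is taken. The algorithm LM is the same without the equal-check rule. Let $\beta^{(\ell)}$ be the fraction of the $n d_v$ variable-to-check messages that have status $0$ at the end of iteration $\ell$. Let $\alpha^{(\ell)}$ be the expected number of status-$0$ messages (that is, the probability of status $0$) on an edge leaving the root, at the end of iteration $\ell$, when the same algorithm runs on the infinite tree in which every variable node has degree $d_v$ and every check node degree $d_c$, rooted at a variable node, with i.i.d. weights and signal elements as above. **Theorem.** There exist constants $\mu,\eta>0$ depending only on $d_v,d_c,\ell$ such that for both algorithms, all probability distributions $f,g$ on $\mathbb R$, all $\alpha\in[0,1]$, all $n,m$ as above and all $\epsilon>0$: (i) $\Pr\left[\,|\beta^{(\ell)}-\mathbf E[\beta^{(\ell)}]|>\epsilon/2\,\right]\le 2e^{-\epsilon^2 n/\mu}$; (ii) if $n>2\eta/\epsilon$, then $|\mathbf E[\beta^{(\ell)}]-\alpha^{(\ell)}|<\epsilon/2$.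 -/

import Mathlib

open MeasureTheory ProbabilityTheory

noncomputable section

/-! ### Biregular sensing graphs -/

/-- A (simple, bipartite) `(dv, dc)`-biregular graph with variable nodes `V` and check nodes `C`:
every variable node has exactly `dv` neighbouring check nodes and every check node has exactly
`dc` neighbouring variable nodes. `V` and `C` may be infinite. -/
@[ext]
structure BiregularGraph (dv dc : ℕ) (V C : Type*) where
  /-- the check nodes adjacent to a variable node -/
  varNbrs : V → Finset C
  /-- the variable nodes adjacent to a check node -/
  chkNbrs : C → Finset V
  mem_chkNbrs : ∀ v c, v ∈ chkNbrs c ↔ c ∈ varNbrs v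
  card_varNbrs : ∀ v, (varNbrs v).card = dv
  card_chkNbrs : ∀ c, (chkNbrs c).card = dc

/-- Graphs carry the discrete sigma-algebra. -/
instance BiregularGraph.instMeasurableSpace (dv dc : ℕ) (V C : Type*) :
    MeasurableSpace (BiregularGraph dv dc V C) := ⊤

/-! ### The verification-based message-passing algorithms -/

/-- The two algorithms: `SBB` uses the rules ZCN, DOCN and ECN; `LM` uses ZCN and DOCN only. -/
inductive VBAlgorithm
  | LM
  | SBB

/-- Messages sent by variable nodes: status flag (`true` = verified) and verified value. -/
abbrev VarMsg := Bool × ℝ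

/-- Messages sent by check nodes: the number of unverified neighbours, and the residual value. -/
abbrev ChkMsg := ℕ × ℝ

section MappingFunctions

variable {ι : Type*}

/-- Candidate values of the rule DOCN: the values of the incoming messages `(1, c)`. -/
def docnValues (S : Finset ι) (o : ι → ChkMsg) : Finset ℝ :=
  open Classical in (S.filter fun i => (o i).1 = 1).image fun i => (o i).2

/-- Candidate values of the rule ECN: the values carried by at least two incoming messages. -/
def ecnValues (S : Finset ι) (o : ι → ChkMsg) : Finset ℝ :=
  open Classical in
    (S.filter fun i => ∃ j ∈ S, j ≠ i ∧ (o j).2 = (o i).2).image fun i => (o i).2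

/-- Verify with the value in `T` if there is one. (If `T` has several elements, which can only
occur after or together with a false verification, the smallest one is taken.) -/
def verifyWith (T : Finset ℝ) : VarMsg :=
  open Classical in if h : T.Nonempty then (true, T.min' h) else (false, 0)

/-- The mapping function of an unverified variable node in the first round of an iteration; the
incoming messages are `o i`, `i ∈ S`. -/
def phiV1 (alg : VBAlgorithm) (S : Finset ι) (o : ι → ChkMsg) : VarMsg :=
  open Classical in
    if (docnValues S o).Nonempty then verifyWith (docnValues S o)
    else match alg with
      | .LM => (false, 0)
      | .SBB => verifyWith (ecnValues S o)

/-- The mapping function of an unverified variable node in the second round (rule ZCN). -/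
def phiV2 (S : Finset ι) (o : ι → ChkMsg) : VarMsg :=
  open Classical in if ∃ i ∈ S, (o i).2 = 0 then (true, 0) else (false, 0)

/-- The mapping function of a check node of degree `dc` and measurement `y`, with incoming
messages `a i`, `i ∈ S`. -/
def phiC (dc : ℕ) (y : ℝ) (S : Finset ι) (a : ι → VarMsg) : ChkMsg :=
  (dc - ∑ i ∈ S, (if (a i).1 then 1 else 0), y - ∑ i ∈ S, (if (a i).1 then (a i).2 else 0))

end MappingFunctions

section Algorithm

variable {dv dc : ℕ} {V C : Type*}

/-- The measurement at check node `c` of the signal `x`, with edge weights `w`. -/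
def measurement (G : BiregularGraph dv dc V C) (w : V × C → ℝ) (x : V → ℝ) (c : C) : ℝ :=
  ∑ v ∈ G.chkNbrs c, w (v, c) * x v

/-- The message sent by the check node `c` when `s v` is the last message sent by the variable
node `v`; an edge multiplies the values leaving a variable node by its weight. -/
def checkOut (G : BiregularGraph dv dc V C) (w : V × C → ℝ) (x : V → ℝ) (s : V → VarMsg)
    (c : C) : ChkMsg :=
  phiC dc (measurement G w x c) (G.chkNbrs c) fun v => ((s v).1, w (v, c) * (s v).2)

/-- One round, with mapping function `Φ` at the unverified variable nodes; a verified variable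
node repeats its message, and an edge divides the values entering a variable node by its weight.
A variable node sends one and the same message along all its edges. -/
def vbRound (Φ : Finset C → (C → ChkMsg) → VarMsg) (G : BiregularGraph dv dc V C)
    (w : V × C → ℝ) (x : V → ℝ) (s : V → VarMsg) (v : V) : VarMsg :=
  if (s v).1 then s v
  else Φ (G.varNbrs v) fun c => ((checkOut G w x s c).1, (checkOut G w x s c).2 / w (v, c))

/-- The messages sent by the variable nodes at the end of iteration `ℓ`. Initially everything is
unverified, so that the check nodes first send `(dc, measurement)`; each iteration consists of a
first and a second round. -/
def varOut (alg : VBAlgorithm) (G : BiregularGraph dv dc V C) (w : V × C → ℝ) (x : V → ℝ) :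
    ℕ → V → VarMsg
  | 0 => fun _ => (false, 0)
  | ℓ + 1 => vbRound phiV2 G w x (vbRound (phiV1 alg) G w x (varOut alg G w x ℓ))

/-- The fraction of the variable-to-check messages (one for each edge) that have unverified
status at iteration `ℓ`. -/
def unverifiedFraction [Fintype V] [Fintype C] (alg : VBAlgorithm) (ℓ : ℕ)
    (G : BiregularGraph dv dc V C) (w : V × C → ℝ) (x : V → ℝ) : ℝ :=
  open Classical in
    ((Finset.univ.filter fun e : V × C =>
        e.2 ∈ G.varNbrs e.1 ∧ (varOut alg G w x ℓ e.1).1 = false).card : ℝ) /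
      ((Finset.univ.filter fun e : V × C => e.2 ∈ G.varNbrs e.1).card : ℝ)

end Algorithm

/-! ### Random weights, signals and graphs -/

/-- The law of a signal element: `0` with probability `1 - α`, and distributed according to `g`
with probability `α`. -/
def signalLaw (g : Measure ℝ) (α : unitInterval) : Measure ℝ :=
  ENNReal.ofReal (1 - (α : ℝ)) • Measure.dirac 0 + ENNReal.ofReal (α : ℝ) • g

instance signalLaw.instIsProbabilityMeasure (g : Measure ℝ) [IsProbabilityMeasure g]
    (α : unitInterval) : IsProbabilityMeasure (signalLaw g α) := by
  constructor
  have h1 : (0 : ℝ) ≤ 1 - α := sub_nonneg.2 α.2.2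
  simp [signalLaw, ← ENNReal.ofReal_add h1 α.2.1]

/-- The joint law of the weights (i.i.d. with law `f`) and the signal elements (i.i.d. with law
`signalLaw g α`), all independent. A weight is attached to every pair of a variable and a check
node; only those of the edges of the graph are ever used. -/
def dataLaw (V C : Type*) (f g : Measure ℝ) [IsProbabilityMeasure f] [IsProbabilityMeasure g]
    (α : unitInterval) : Measure ((V × C → ℝ) × (V → ℝ)) :=
  (Measure.infinitePi fun _ : V × C => f).prod (Measure.infinitePi fun _ : V => signalLaw g α)

/-- The joint law of the graph, the weights and the signal: the graph is uniform among all
`(dv, dc)`-biregular graphs with `n` variable nodes and `m` check nodes, and independent of the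
weights and of the signal. -/
def ensembleLaw (dv dc n m : ℕ) (f g : Measure ℝ) [IsProbabilityMeasure f]
    [IsProbabilityMeasure g] (α : unitInterval) :
    Measure (BiregularGraph dv dc (Fin n) (Fin m) × ((Fin n × Fin m → ℝ) × (Fin n → ℝ))) :=
  (uniformOn Set.univ).prod (dataLaw (Fin n) (Fin m) f g α)

/-! ### The cycle-free graph -/

/-- Check nodes of the infinite biregular tree rooted at a variable node. -/
inductive TreeCheck (dv dc : ℕ)
  /-- the `i`-th check node adjacent to the root -/
  | top (i : Fin dv) : TreeCheck dv dc
  /-- the `i`-th child of the `j`-th child of the check node `c` -/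
  | deeper (c : TreeCheck dv dc) (j : Fin (dc - 1)) (i : Fin (dv - 1)) : TreeCheck dv dc

/-- Variable nodes of the infinite biregular tree rooted at a variable node. -/
inductive TreeVar (dv dc : ℕ)
  /-- the root -/
  | root : TreeVar dv dc
  /-- the `j`-th child of the check node `c` -/
  | child (c : TreeCheck dv dc) (j : Fin (dc - 1)) : TreeVar dv dc

/-- The parent of a check node. -/
def TreeCheck.parent {dv dc : ℕ} : TreeCheck dv dc → TreeVar dv dc
  | .top _ => .root
  | .deeper c j _ => .child c j

/-- The neighbours of a variable node: its children and, except at the root, its parent. -/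
def TreeVar.nbrs {dv dc : ℕ} : TreeVar dv dc → Finset (TreeCheck dv dc)
  | .root => open Classical in Finset.univ.image TreeCheck.top
  | .child c j => open Classical in insert c (Finset.univ.image (TreeCheck.deeper c j))

/-- The neighbours of a check node: its parent and its children. -/
def TreeCheck.nbrs {dv dc : ℕ} (c : TreeCheck dv dc) : Finset (TreeVar dv dc) :=
  open Classical in insert c.parent (Finset.univ.image (TreeVar.child c))

theorem TreeCheck.deeper_ne {dv dc : ℕ} (c : TreeCheck dv dc) (j : Fin (dc - 1))
    (i : Fin (dv - 1)) : TreeCheck.deeper c j i ≠ c := by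
  intro h
  have := congrArg sizeOf h
  simp only [TreeCheck.deeper.sizeOf_spec] at this
  omega

theorem TreeCheck.child_ne_parent {dv dc : ℕ} (c : TreeCheck dv dc) (j : Fin (dc - 1)) :
    TreeVar.child c j ≠ c.parent := by
  cases c with
  | top i => simp [TreeCheck.parent]
  | deeper c k i =>
    intro h
    simp only [TreeCheck.parent, TreeVar.child.injEq] at h
    exact TreeCheck.deeper_ne c k i h.1

/-- The infinite `(dv, dc)`-biregular tree. -/
def biregularTree (dv dc : ℕ) (hdv : 0 < dv) (hdc : 0 < dc) :
    BiregularGraph dv dc (TreeVar dv dc) (TreeCheck dv dc) where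
  varNbrs := TreeVar.nbrs
  chkNbrs := TreeCheck.nbrs
  mem_chkNbrs v c := by
    cases v <;> cases c <;> simp [TreeVar.nbrs, TreeCheck.nbrs, TreeCheck.parent] <;> grind
  card_varNbrs v := by
    classical
    cases v with
    | root =>
      simp only [TreeVar.nbrs]
      rw [Finset.card_image_of_injective _ (fun a b h => by injection h)]
      simp
    | child c j =>
      simp only [TreeVar.nbrs]
      rw [Finset.card_insert_of_notMem,
        Finset.card_image_of_injective _ (fun a b h => by injection h)]
      · simp; omega
      · simp [TreeCheck.deeper_ne]
  card_chkNbrs c := by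
    classical
    simp only [TreeCheck.nbrs]
    rw [Finset.card_insert_of_notMem,
      Finset.card_image_of_injective _ (fun a b h => by injection h)]
    · simp; omega
    · simp [TreeCheck.child_ne_parent]

/-- The expected number of unverified messages (that is, the probability of an unverified status)
on an edge leaving the root of the infinite biregular tree at iteration `ℓ`. -/
def treeUnverified (dv dc : ℕ) (hdv : 0 < dv) (hdc : 0 < dc) (alg : VBAlgorithm) (ℓ : ℕ)
    (f g : Measure ℝ) [IsProbabilityMeasure f] [IsProbabilityMeasure g] (α : unitInterval) : ℝ :=
  (dataLaw (TreeVar dv dc) (TreeCheck dv dc) f g α).real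
    {ω | (varOut alg (biregularTree dv dc hdv hdc) ω.1 ω.2 ℓ .root).1 = false}

end

/-! After `ℓ` iterations the status of a variable node is determined by a part of the graph of
bounded radius. Both bounds rest on this locality and on one switching estimate for uniform
biregular graphs.

Concentration. Since a variable node sends one message to all its neighbours, the quantity is a
fraction of variable nodes (`unverifiedFraction_eq`). Altering one weight, one signal element or a
few neighbourhoods changes proportionally few messages (`card_varOut_ne_le`), hence moves the
fraction by `O(1/n)` per alteration. For a fixed graph, McDiarmid's inequality
(`CenteredMGFBound.pi`) gives a variance proxy `O(1/n)`. The graph has no product law, so the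
neighbourhoods of the variable nodes are revealed one at a time, and the increments of the resulting
martingale are bounded (`abs_avg_reveal_sub_le`). Two conditional families in which `v` has
neighbour `a`, respectively `b` instead, are matched by the switchings that trade the edges `(v,
a)`, `(u, b)` for `(v, b)`, `(u, a)` with `u` unrevealed. The number of admissible `u` varies with
the graph, but only by the codegree of `a` and `b` in the unrevealed set `s`, which is `O(1/|s|)` on
average; an `L`-Lipschitz function oscillates by at most `L|s|` on the family, so weighting graphs
by the number of admissible `u` shifts its mean by `O(L)` only (`abs_avg_sub_exchange_le`). The
martingale bound is `avg_exp_extensions_le`; `CenteredMGFBound.prod` adds the variance proxies of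
graph and data, and `CenteredMGFBound.measureReal_le` is the Chernoff bound.

Mean. Every biregular graph is covered by the infinite tree (`exists_isCovering`), and the algorithm
commutes with coverings (`IsCovering.varOut_eq`). If the covering is injective on a fixed finite
subtree carrying everything the root reads, the root has the same law as in the tree. Otherwise the
graph contains the image of a part of that subtree closed up by one additional edge
(`injective_of_not_closesAt`). Given the image, the additional edge has probability `O(1/n)` by
`card_containing_insert_mul_le`, and a graph of bounded degree contains boundedly many rooted
images, so this event has probability `O(1/n)` (`card_closesNear_mul_le`). -/

noncomputable section

/-! ### Switchings and the probability of one more edge -/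

section Switching

variable {V C : Type*}

/-- The neighbourhood function of a biregular graph. -/
def IsBiregular [Fintype V] [DecidableEq C] (dv dc : ℕ) (N : V → Finset C) : Prop :=
  (∀ v, (N v).card = dv) ∧ ∀ c, (Finset.univ.filter fun v => c ∈ N v).card = dc

/-- Exchange the edges `(v, a)`, `(u, b)` and the non-edges `(v, b)`, `(u, a)`. -/
def switch [DecidableEq V] [DecidableEq C] (v u : V) (a b : C) (N : V → Finset C) :
    V → Finset C :=
  fun z => if z = v ∨ z = u then symmDiff (N z) {a, b} else N z

section Basic

variable [DecidableEq V] [DecidableEq C]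

/-- The symmetric difference in the definition makes a switching an involution with no condition on
the edges, so switchings are undone by repeating them. -/
theorem switch_switch (v u : V) (a b : C) (N : V → Finset C) :
    switch v u a b (switch v u a b N) = N := by
  funext z
  by_cases h : z = v ∨ z = u <;> simp [switch, h]

theorem switch_comm (v u : V) (a b : C) (N : V → Finset C) :
    switch v u a b N = switch u v b a N := by
  funext z
  simp [switch, or_comm, Finset.pair_comm]

theorem mem_switch {v u : V} {a b : C} {N : V → Finset C} {z : V} {c : C} :
    c ∈ switch v u a b N z ↔
      if (z = v ∨ z = u) ∧ (c = a ∨ c = b) then c ∉ N z else c ∈ N z := by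
  by_cases h : z = v ∨ z = u <;> by_cases h' : c = a ∨ c = b <;>
    simp [switch, h, h', Finset.mem_symmDiff]

theorem switch_of_ne {v u : V} {a b : C} {N : V → Finset C} {z : V} (h1 : z ≠ v) (h2 : z ≠ u) :
    switch v u a b N z = N z := by
  simp [switch, h1, h2]

theorem switch_left {v u : V} {a b : C} {N : V → Finset C} (ha : a ∈ N v) (hb : b ∉ N v) :
    switch v u a b N v = insert b ((N v).erase a) := by
  ext c
  rw [mem_switch]
  simp only [Finset.mem_insert, Finset.mem_erase]
  grind

theorem IsBiregular.switch [Fintype V] {dv dc : ℕ} {N : V → Finset C}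
    (h : IsBiregular dv dc N) {v u : V} {a b : C} (hav : a ∈ N v) (hbv : b ∉ N v) (hbu : b ∈ N u)
    (hau : a ∉ N u) : IsBiregular dv dc (switch v u a b N) := by
  have hvu : v ≠ u := by rintro rfl; exact hau hav
  have hab : a ≠ b := by rintro rfl; exact hbv hav
  have card_aux : ∀ {w z : V} {c d : C} (M : V → Finset C), c ∈ M w → d ∉ M w →
      (_root_.switch w z c d M w).card = (M w).card := by
    intro w z c d M hc hd
    rw [switch_left hc hd, Finset.card_insert_of_notMem (by simp [hd]),
      Finset.card_erase_of_mem hc]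
    have := Finset.card_pos.2 ⟨c, hc⟩
    omega
  have deg_aux : ∀ {w z : V} {c d : C} (M : V → Finset C), w ≠ z → c ∈ M w → c ∉ M z →
      (Finset.univ.filter fun y => c ∈ _root_.switch w z c d M y).card =
        (Finset.univ.filter fun y => c ∈ M y).card := by
    intro w z c d M hwz hc hz
    have : (Finset.univ.filter fun y => c ∈ _root_.switch w z c d M y) =
        insert z ((Finset.univ.filter fun y => c ∈ M y).erase w) := by
      ext y
      simp only [Finset.mem_filter, Finset.mem_univ, true_and, Finset.mem_insert,
        Finset.mem_erase, mem_switch]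
      grind
    rw [this, Finset.card_insert_of_notMem (by simp [hz]), Finset.card_erase_of_mem (by simp [hc])]
    have : 0 < (Finset.univ.filter fun y => c ∈ M y).card :=
      Finset.card_pos.2 ⟨w, by simpa using hc⟩
    omega
  refine ⟨fun z => ?_, fun c => ?_⟩
  · rw [← h.1 z]
    by_cases hzv : z = v
    · subst hzv; exact card_aux N hav hbv
    by_cases hzu : z = u
    · subst hzu; rw [switch_comm]; exact card_aux N hbu hau
    · rw [switch_of_ne hzv hzu]
  · rw [← h.2 c]
    by_cases hca : c = a
    · subst hca; exact deg_aux N hvu hav hau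
    by_cases hcb : c = b
    · subst hcb
      simp_rw [switch_comm v u]
      exact deg_aux N hvu.symm hbu hbv
    · simp [mem_switch, hca, hcb]

end Basic

variable [Fintype V] [Fintype C] [DecidableEq V] [DecidableEq C]

/-- The biregular graphs that agree with `N₀` outside of `s`. -/
def extensions (dv dc : ℕ) (s : Finset V) (N₀ : V → Finset C) : Finset (V → Finset C) :=
  open Classical in Finset.univ.filter fun N => IsBiregular dv dc N ∧ ∀ v ∉ s, N v = N₀ v

/-- The members of the family `X` that contain all the edges in `H`. -/
def containing (X : Finset (V → Finset C)) (H : Finset (V × C)) : Finset (V → Finset C) :=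
  X.filter fun N => ∀ e ∈ H, e.2 ∈ N e.1

theorem mem_extensions {dv dc : ℕ} {s : Finset V} {N₀ N : V → Finset C} :
    N ∈ extensions dv dc s N₀ ↔ IsBiregular dv dc N ∧ ∀ v ∉ s, N v = N₀ v := by
  simp [extensions]

theorem mem_containing {X : Finset (V → Finset C)} {H : Finset (V × C)} {N : V → Finset C} :
    N ∈ containing X H ↔ N ∈ X ∧ ∀ e ∈ H, e.2 ∈ N e.1 := by
  simp [containing]

/-- The switching bound for the number of graphs that contain one more edge. -/
theorem card_containing_insert_mul_le {dv dc : ℕ} (s : Finset V) (N₀ : V → Finset C)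
    (H : Finset (V × C)) {v : V} {c : C} (hv : v ∈ s) (hH : (v, c) ∉ H) :
    (containing (extensions dv dc s N₀) (insert (v, c) H)).card * (s.card * dv) ≤
      dv * dc * (containing (extensions dv dc s N₀) H).card +
      (containing (extensions dv dc s N₀) (insert (v, c) H)).card * (H.card + 2 * (dv * dc)) := by
  set Y := containing (extensions dv dc s N₀) H with hY
  set X := containing (extensions dv dc s N₀) (insert (v, c) H) with hX
  let E : (V → Finset C) → Finset (V × C) := fun N =>
    (s ×ˢ Finset.univ).filter fun e => e.2 ∈ N e.1
  -- The edges `(u, b)` against which `(v, c)` can be switched without creating a double edge,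
  -- destroying an edge of `H` or touching a node outside `s`.
  let W : (V → Finset C) → Finset (V × C) := fun N =>
    (s ×ˢ Finset.univ).filter fun e => e.2 ∈ N e.1 ∧ e ∉ H ∧ c ∉ N e.1 ∧ e.2 ∉ N v
  let Z : (V → Finset C) → Finset (V × C) := fun N =>
    (Finset.univ.filter fun u => c ∈ N u) ×ˢ N v
  have hXmem : ∀ N ∈ X, IsBiregular dv dc N ∧ (∀ z ∉ s, N z = N₀ z) ∧ c ∈ N v ∧
      ∀ e ∈ H, e.2 ∈ N e.1 := by
    intro N hN
    rw [hX, mem_containing, mem_extensions] at hN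
    exact ⟨hN.1.1, hN.1.2, hN.2 (v, c) (by simp), fun e he => hN.2 e (by simp [he])⟩
  have hE : ∀ N ∈ X, (E N).card = s.card * dv := by
    intro N hN
    have : E N = (s.sigma N).image fun p => (p.1, p.2) := by
      ext ⟨u, b⟩
      simp [E]
    rw [this, Finset.card_image_of_injective, Finset.card_sigma]
    · simp [(hXmem N hN).1.1]
    · rintro ⟨u, b⟩ ⟨u', b'⟩ h
      simpa using h
  have hW : ∀ N ∈ X, s.card * dv ≤ (W N).card + (H.card + 2 * (dv * dc)) := by
    intro N hN
    have hN' := (hXmem N hN).1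
    -- An unusable edge lies in `H`, or starts at one of the `dc` neighbours of `c`, or ends at one
    -- of the `dv` neighbours of `v`.
    have hsub : E N ⊆ W N ∪ (H ∪ ((Finset.univ.filter fun u => c ∈ N u).biUnion
        (fun u => (N u).image fun b => (u, b)) ∪
        (N v).biUnion (fun b => (Finset.univ.filter fun u => b ∈ N u).image fun u => (u, b)))) := by
      rintro ⟨u, b⟩ h
      simp only [E, W, Finset.mem_filter, Finset.mem_union, Finset.mem_biUnion, Finset.mem_image,
        Finset.mem_univ, true_and, Prod.mk.injEq, Finset.mem_product, and_true] at h ⊢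
      by_cases h1 : (u, b) ∈ H
      · simp [h1]
      by_cases h2 : c ∈ N u
      · exact Or.inr (Or.inr (Or.inl ⟨u, h2, b, h.2, rfl, rfl⟩))
      by_cases h3 : b ∈ N v
      · exact Or.inr (Or.inr (Or.inr ⟨b, h3, u, h.2, rfl, rfl⟩))
      · exact Or.inl ⟨h.1, h.2, h1, h2, h3⟩
    rw [← hE N hN]
    refine (Finset.card_le_card hsub).trans ((Finset.card_union_le _ _).trans ?_)
    gcongr
    refine (Finset.card_union_le _ _).trans ?_
    gcongr
    refine (Finset.card_union_le _ _).trans ?_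
    rw [two_mul]
    gcongr
    · rw [mul_comm]
      refine Finset.card_biUnion_le_card_mul _ _ _ (fun u _ => ?_) |>.trans (by rw [hN'.2])
      exact Finset.card_image_le.trans (hN'.1 u).le
    · refine Finset.card_biUnion_le_card_mul _ _ _ (fun b _ => ?_) |>.trans (by rw [hN'.1])
      exact Finset.card_image_le.trans (hN'.2 b).le
  -- Double counting: each switching is recorded with its edge `(u, b)` and is therefore reversible.
  -- Afterwards `u` is a neighbour of `c` and `b` one of `v`, which leaves at most `dc * dv` records
  -- per graph.
  have key : (X.sigma W).card ≤ (Y.sigma Z).card := by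
    refine Finset.card_le_card_of_injOn (fun p => ⟨switch v p.2.1 c p.2.2 p.1, p.2⟩) ?_ ?_
    · rintro ⟨N, u, b⟩ h
      simp only [Finset.coe_sigma, Set.mem_sigma_iff, Finset.mem_coe, W, Z, Finset.mem_filter,
        Finset.mem_product, Finset.mem_univ, and_true, true_and] at h ⊢
      obtain ⟨hN, hus, hbu, hubH, hcu, hbv⟩ := h
      obtain ⟨hN1, hN2, hN3, hN4⟩ := hXmem N hN
      rw [hY, mem_containing, mem_extensions]
      refine ⟨⟨⟨hN1.switch hN3 hbv hbu hcu, fun z hz => ?_⟩, ?_⟩, ?_, ?_⟩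
      · rw [switch_of_ne (by rintro rfl; exact hz hv) (by rintro rfl; exact hz hus)]
        exact hN2 z hz
      · rintro ⟨z, d⟩ he
        have := hN4 _ he
        simp only at this
        rw [mem_switch]
        grind
      · rw [mem_switch]; simp [hcu]
      · rw [mem_switch]; simp [hbv]
    · rintro ⟨N, u, b⟩ - ⟨N', u', b'⟩ - h
      simp only [Sigma.mk.injEq, heq_eq_eq] at h
      obtain ⟨h, h'⟩ := h
      obtain ⟨rfl, rfl⟩ := Prod.mk.inj h'
      have := congrArg (switch v u c b) h
      rw [switch_switch, switch_switch] at this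
      rw [this]
  rw [Finset.card_sigma, Finset.card_sigma] at key
  have h1 : X.card * (s.card * dv) ≤ ∑ N ∈ X, (W N).card + X.card * (H.card + 2 * (dv * dc)) := by
    rw [← smul_eq_mul, ← smul_eq_mul (a := X.card), ← Finset.sum_const, ← Finset.sum_const,
      ← Finset.sum_add_distrib]
    exact Finset.sum_le_sum hW
  have h2 : ∑ N ∈ Y, (Z N).card = dv * dc * Y.card := by
    rw [mul_comm, ← smul_eq_mul (a := Y.card), ← Finset.sum_const]
    refine Finset.sum_congr rfl fun N hN => ?_
    rw [hY, mem_containing, mem_extensions] at hN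
    rw [Finset.card_product, hN.1.1.1, hN.1.1.2, mul_comm]
  omega

end Switching

/-! ### Weighted averages and Hoeffding's lemma on finite sets -/

section Average

variable {ι : Type*}

/-- The average of `F` over the finite set `X`. -/
def avg (X : Finset ι) (F : ι → ℝ) : ℝ := (∑ x ∈ X, F x) / X.card

theorem card_mul_avg (X : Finset ι) (F : ι → ℝ) : X.card * avg X F = ∑ x ∈ X, F x := by
  rcases X.eq_empty_or_nonempty with rfl | h
  · simp
  · have : (X.card : ℝ) ≠ 0 := by exact_mod_cast h.card_pos.ne'
    rw [avg, mul_div_cancel₀ _ this]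

theorem abs_sub_weighted_le {X : Finset ι} {F p : ι → ℝ} {M c : ℝ} (hp : ∀ x ∈ X, 0 ≤ p x)
    (hS : 0 < ∑ x ∈ X, p x) (hM : ∀ x ∈ X, |c - F x| ≤ M) :
    |c - (∑ x ∈ X, p x * F x) / ∑ x ∈ X, p x| ≤ M := by
  rw [sub_div' hS.ne', abs_div, abs_of_pos hS, div_le_iff₀ hS]
  calc |c * ∑ x ∈ X, p x - ∑ x ∈ X, p x * F x|
      = |∑ x ∈ X, p x * (c - F x)| := by
        rw [Finset.mul_sum, ← Finset.sum_sub_distrib]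
        exact congrArg _ (Finset.sum_congr rfl fun x _ => by ring)
    _ ≤ ∑ x ∈ X, |p x * (c - F x)| := Finset.abs_sum_le_sum_abs _ _
    _ ≤ ∑ x ∈ X, M * p x := Finset.sum_le_sum fun x hx => by
        rw [abs_mul, abs_of_nonneg (hp x hx), mul_comm]
        exact mul_le_mul_of_nonneg_right (hM x hx) (hp x hx)
    _ = M * ∑ x ∈ X, p x := by rw [Finset.mul_sum]

theorem abs_sub_avg_le {X : Finset ι} {F : ι → ℝ} {M c : ℝ} (hX : X.Nonempty)
    (hM : ∀ x ∈ X, |c - F x| ≤ M) : |c - avg X F| ≤ M := by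
  have := abs_sub_weighted_le (X := X) (F := F) (p := fun _ => 1) (M := M) (c := c) (by simp)
    (by simpa using hX) hM
  simpa [avg] using this

theorem abs_avg_sub_avg_le_of_forall {X Y : Finset ι} {F F' : ι → ℝ} {M : ℝ}
    (hX : X.Nonempty) (hY : Y.Nonempty) (h : ∀ x ∈ X, ∀ y ∈ Y, |F x - F' y| ≤ M) :
    |avg X F - avg Y F'| ≤ M := by
  refine abs_sub_avg_le hY fun y hy => ?_
  rw [abs_sub_comm]
  exact abs_sub_avg_le hX fun x hx => by rw [abs_sub_comm]; exact h x hx y hy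

/-- An average and a weighted average with nearly constant weights are close. -/
theorem abs_avg_sub_weighted_le {X : Finset ι} {F p γ : ι → ℝ} {k M δ : ℝ}
    (hX : X.Nonempty) (hk : 1 ≤ k) (hp : ∀ x ∈ X, 0 ≤ p x) (hγ : ∀ x ∈ X, 0 ≤ γ x)
    (hsum : ∀ x ∈ X, p x + γ x = k) (hδ : ∑ x ∈ X, γ x ≤ δ * X.card) (hM0 : 0 ≤ M)
    (hS : 0 < ∑ x ∈ X, p x) (hM : ∀ x ∈ X, ∀ y ∈ X, |F x - F y| ≤ M) :
    |avg X F - (∑ x ∈ X, p x * F x) / ∑ x ∈ X, p x| ≤ M * δ := by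
  set c := (∑ x ∈ X, p x * F x) / ∑ x ∈ X, p x with hc
  have hcM : ∀ x ∈ X, |F x - c| ≤ M := fun x hx => abs_sub_weighted_le hp hS (hM x hx)
  have hn : (0 : ℝ) < X.card := by exact_mod_cast hX.card_pos
  have h0 : ∑ x ∈ X, p x * (F x - c) = 0 := by
    simp_rw [mul_sub, Finset.sum_sub_distrib, ← Finset.sum_mul]
    rw [hc, mul_div_cancel₀ _ hS.ne', sub_self]
  -- As `p + γ = k` and the `p`-weighted deviations from `c` cancel, only the small defect `γ`
  -- contributes.
  have h1 : k * (X.card * (avg X F - c)) = ∑ x ∈ X, γ x * (F x - c) := by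
    rw [mul_sub, card_mul_avg, ← nsmul_eq_mul, ← Finset.sum_const, ← Finset.sum_sub_distrib,
      Finset.mul_sum, ← zero_add (∑ x ∈ X, γ x * (F x - c)), ← h0, ← Finset.sum_add_distrib]
    exact Finset.sum_congr rfl fun x hx => by rw [← hsum x hx]; ring
  have h2 : |∑ x ∈ X, γ x * (F x - c)| ≤ M * (δ * X.card) := by
    calc _ ≤ ∑ x ∈ X, |γ x * (F x - c)| := Finset.abs_sum_le_sum_abs _ _
      _ ≤ ∑ x ∈ X, M * γ x := Finset.sum_le_sum fun x hx => by
        rw [abs_mul, abs_of_nonneg (hγ x hx), mul_comm]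
        exact mul_le_mul_of_nonneg_right (hcM x hx) (hγ x hx)
      _ = M * ∑ x ∈ X, γ x := by rw [Finset.mul_sum]
      _ ≤ _ := by gcongr
  have h3 : X.card * |avg X F - c| ≤ M * (δ * X.card) := by
    refine le_trans ?_ h2
    rw [← h1, abs_mul, abs_mul, abs_of_pos hn, abs_of_pos (by linarith : 0 < k)]
    exact le_mul_of_one_le_left (by positivity) hk
  refine le_of_mul_le_mul_left ?_ hn
  linarith

/-- Hoeffding's lemma (with a weaker constant) for a uniform random variable. -/
theorem avg_exp_le {X : Finset ι} {Y : ι → ℝ} {K : ℝ} (hX : X.Nonempty)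
    (hK : ∀ x ∈ X, ∀ y ∈ X, |Y x - Y y| ≤ K) (lam : ℝ) :
    avg X (fun x => Real.exp (lam * (Y x - avg X Y))) ≤ Real.exp (lam ^ 2 * K ^ 2 / 2) := by
  have hn : (0 : ℝ) < X.card := by exact_mod_cast hX.card_pos
  -- Symmetrization: Jensen replaces the mean by an independent copy; exchanging the two copies then
  -- turns `exp` into `cosh t ≤ exp (t ^ 2 / 2)`.
  have hjensen : ∀ x ∈ X, Real.exp (lam * (Y x - avg X Y)) ≤
      avg X (fun y => Real.exp (lam * (Y x - Y y))) := by
    intro x _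
    have := convexOn_exp.map_sum_le (t := X) (w := fun _ => (X.card : ℝ)⁻¹)
      (p := fun y => lam * (Y x - Y y)) (by intros; positivity)
      (by simp [hn.ne']) (by simp)
    simp only [smul_eq_mul, ← Finset.mul_sum] at this
    rw [← div_eq_inv_mul (∑ y ∈ X, _)] at this
    refine le_trans (le_of_eq ?_) this
    rw [← mul_assoc, mul_comm _ lam, mul_assoc]
    congr 2
    rw [Finset.sum_sub_distrib, Finset.sum_const, nsmul_eq_mul, avg]
    field_simp
  have hsq : ∑ x ∈ X, ∑ y ∈ X, Real.exp (lam * (Y x - Y y)) ≤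
      ∑ x ∈ X, ∑ y ∈ X, Real.exp (lam ^ 2 * K ^ 2 / 2) := by
    have hcosh : ∑ x ∈ X, ∑ y ∈ X, Real.exp (lam * (Y x - Y y)) =
        ∑ x ∈ X, ∑ y ∈ X, Real.cosh (lam * (Y x - Y y)) := by
      have hswap : ∑ x ∈ X, ∑ y ∈ X, Real.exp (lam * (Y x - Y y)) =
          ∑ x ∈ X, ∑ y ∈ X, Real.exp (-(lam * (Y x - Y y))) := by
        rw [Finset.sum_comm]
        refine Finset.sum_congr rfl fun x _ => Finset.sum_congr rfl fun y _ => ?_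
        congr 1; ring
      simp_rw [Real.cosh_eq, ← Finset.sum_div, Finset.sum_add_distrib]
      rw [← hswap]; ring
    rw [hcosh]
    refine Finset.sum_le_sum fun x hx => Finset.sum_le_sum fun y hy =>
      (Real.cosh_le_exp_half_sq _).trans (Real.exp_le_exp.2 ?_)
    rw [mul_pow]
    have : (Y x - Y y) ^ 2 ≤ K ^ 2 := sq_le_sq' (by linarith [abs_le.1 (hK x hx y hy)])
      (abs_le.1 (hK x hx y hy)).2
    gcongr
  rw [avg, div_le_iff₀ hn]
  calc _ ≤ ∑ x ∈ X, avg X (fun y => Real.exp (lam * (Y x - Y y))) := Finset.sum_le_sum hjensen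
    _ = (∑ x ∈ X, ∑ y ∈ X, Real.exp (lam * (Y x - Y y))) / X.card := by
      simp_rw [avg, Finset.sum_div]
    _ ≤ (∑ x ∈ X, ∑ y ∈ X, Real.exp (lam ^ 2 * K ^ 2 / 2)) / X.card := by gcongr
    _ = _ := by
      simp only [Finset.sum_const, nsmul_eq_mul]
      field_simp

end Average

/-! ### The martingale that reveals the graph one neighbourhood at a time -/

section Revealing

variable {V C : Type*} [Fintype V] [Fintype C] [DecidableEq V] [DecidableEq C] {dv dc : ℕ}

/-- `F` changes by at most `L` times the number of changed neighbourhoods. -/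
def HammingLipschitz (dv dc : ℕ) (L : ℝ) (F : (V → Finset C) → ℝ) : Prop :=
  ∀ N N', IsBiregular dv dc N → IsBiregular dv dc N' →
    |F N - F N'| ≤ L * (Finset.univ.filter fun v => N v ≠ N' v).card

/-- The revealed part fixes how many unrevealed neighbours each check node still has. This is the
constant total weight needed for `abs_avg_sub_weighted_le`. -/
theorem card_filter_add_card_filter_eq {s : Finset V} {N₀ N : V → Finset C}
    (hN : N ∈ extensions dv dc s N₀) (c : C) :
    (s.filter fun u => c ∈ N u).card + (sᶜ.filter fun u => c ∈ N₀ u).card = dc := by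
  rw [mem_extensions] at hN
  rw [← hN.1.2 c, ← Finset.card_filter_add_card_filter_not (s := Finset.univ.filter fun v => c ∈ N v)
    (fun v => v ∈ s)]
  congr 2
  · ext u; simp [and_comm]
  · ext u
    simp only [Finset.mem_filter, Finset.mem_compl, Finset.mem_univ, true_and]
    constructor
    · rintro ⟨h1, h2⟩; exact ⟨by rwa [hN.2 u h1], h1⟩
    · rintro ⟨h1, h2⟩; exact ⟨h2, by rwa [← hN.2 u h2]⟩

theorem HammingLipschitz.abs_sub_le {L : ℝ} {F : (V → Finset C) → ℝ}
    (hF : HammingLipschitz dv dc L F) (hL : 0 ≤ L) {s : Finset V} {N₀ N N' : V → Finset C}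
    (hN : N ∈ extensions dv dc s N₀) (hN' : N' ∈ extensions dv dc s N₀) :
    |F N - F N'| ≤ L * s.card := by
  rw [mem_extensions] at hN hN'
  refine (hF N N' hN.1 hN'.1).trans (mul_le_mul_of_nonneg_left ?_ hL)
  refine Nat.cast_le.2 (Finset.card_le_card fun u hu => ?_)
  by_contra h
  exact (Finset.mem_filter.1 hu).2 ((hN.2 u h).trans (hN'.2 u h).symm)

/-- In a uniform graph, two check nodes have few common neighbours. -/
theorem sum_codegree_mul_le (hdv : 0 < dv) {s : Finset V} {N₀ : V → Finset C} {a b : C}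
    (hab : a ≠ b) (hs : 2 + 4 * (dv * dc) ≤ s.card) :
    (∑ N ∈ extensions dv dc s N₀, (s.filter fun u => b ∈ N u ∧ a ∈ N u).card) * s.card ≤
      2 * dc ^ 2 * (extensions dv dc s N₀).card := by
  set X := extensions dv dc s N₀ with hX
  -- The switching bound with `H = {(u, a)}`. As `s` is large, its error term is at most half of the
  -- left side, whence the factor 2.
  have h1 : ∀ u ∈ s, (X.filter fun N => b ∈ N u ∧ a ∈ N u).card * s.card ≤
      2 * dc * (X.filter fun N => a ∈ N u).card := by
    intro u hu
    have h := card_containing_insert_mul_le (dv := dv) (dc := dc) s N₀ {(u, a)} (v := u) (c := b) hu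
      (by simp [hab.symm])
    have e1 : containing X (insert (u, b) {(u, a)}) = X.filter fun N => b ∈ N u ∧ a ∈ N u := by
      ext N; simp [mem_containing]
    have e2 : containing X {(u, a)} = X.filter fun N => a ∈ N u := by
      ext N; simp [mem_containing]
    rw [← hX, e1, e2, Finset.card_singleton] at h
    set x := (X.filter fun N => b ∈ N u ∧ a ∈ N u).card
    set y := (X.filter fun N => a ∈ N u).card
    have h2 : 2 * (1 + 2 * (dv * dc)) ≤ s.card * dv := by
      calc _ ≤ s.card := by omega
        _ ≤ s.card * dv := Nat.le_mul_of_pos_right _ hdv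
    have h3 : x * (2 * (1 + 2 * (dv * dc))) ≤ x * (s.card * dv) := Nat.mul_le_mul_left _ h2
    refine Nat.le_of_mul_le_mul_right ?_ hdv
    nlinarith
  have h2 : ∑ N ∈ X, (s.filter fun u => b ∈ N u ∧ a ∈ N u).card =
      ∑ u ∈ s, (X.filter fun N => b ∈ N u ∧ a ∈ N u).card := by
    simp_rw [Finset.card_filter]
    exact Finset.sum_comm
  have h3 : ∑ u ∈ s, (X.filter fun N => a ∈ N u).card ≤ X.card * dc := by
    calc _ = ∑ N ∈ X, (s.filter fun u => a ∈ N u).card := by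
          simp_rw [Finset.card_filter]
          exact Finset.sum_comm
      _ ≤ ∑ N ∈ X, dc := Finset.sum_le_sum fun N hN => by
          have := card_filter_add_card_filter_eq hN a
          omega
      _ = _ := by simp
  rw [h2, Finset.sum_mul]
  calc _ ≤ ∑ u ∈ s, 2 * dc * (X.filter fun N => a ∈ N u).card := Finset.sum_le_sum h1
    _ = 2 * dc * ∑ u ∈ s, (X.filter fun N => a ∈ N u).card := by rw [Finset.mul_sum]
    _ ≤ 2 * dc * (X.card * dc) := Nat.mul_le_mul_left _ h3
    _ = _ := by ring

/-- The unrevealed variable nodes through which `b` can be exchanged for `a`. -/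
def exchangers (s : Finset V) (a b : C) (N : V → Finset C) : Finset V :=
  s.filter fun u => b ∈ N u ∧ a ∉ N u

/-- The number of exchangers is the constant residual degree of `b` minus the codegree of `a` and
`b`. The codegree has mean at most `2 * dc ^ 2 / |s|` and `F` oscillates by at most `L * |s|`, so
the two factors of `|s|` cancel. The bound `hs'` keeps the mean codegree below 1, hence the total
weight positive. -/
theorem abs_avg_sub_exchange_le (hdv : 0 < dv) {s : Finset V} {N₀ : V → Finset C} {a b : C}
    (hab : a ≠ b) (hs : 2 + 4 * (dv * dc) ≤ s.card) (hs' : 2 * dc ^ 2 < s.card)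
    {L : ℝ} (hL : 0 ≤ L) {F : (V → Finset C) → ℝ} (hF : HammingLipschitz dv dc L F)
    {N₁ : V → Finset C} (hN₁ : N₁ ∈ extensions dv dc s N₀) (hb : ∃ u ∈ s, b ∈ N₁ u) :
    0 < ∑ N ∈ extensions dv dc s N₀, ((exchangers s a b N).card : ℝ) ∧
    |avg (extensions dv dc s N₀) F -
      (∑ N ∈ extensions dv dc s N₀, (exchangers s a b N).card * F N) /
        ∑ N ∈ extensions dv dc s N₀, ((exchangers s a b N).card : ℝ)| ≤ 2 * dc ^ 2 * L := by
  set X := extensions dv dc s N₀ with hX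
  have hXn : X.Nonempty := ⟨N₁, hN₁⟩
  have hn : (0 : ℝ) < X.card := by exact_mod_cast hXn.card_pos
  have hs0 : (0 : ℝ) < s.card := by exact_mod_cast (by omega : 0 < s.card)
  set k := (s.filter fun u => b ∈ N₁ u).card with hk
  have hk1 : 1 ≤ k := by
    obtain ⟨u, hu, hbu⟩ := hb
    exact Finset.card_pos.2 ⟨u, by simp [hu, hbu]⟩
  have hsum : ∀ N ∈ X, (exchangers s a b N).card +
      (s.filter fun u => b ∈ N u ∧ a ∈ N u).card = k := by
    intro N hN
    have h1 := card_filter_add_card_filter_eq hN b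
    have h2 := card_filter_add_card_filter_eq hN₁ b
    have h3 := Finset.card_filter_add_card_filter_not (s := s.filter fun u => b ∈ N u)
      (fun u => a ∈ N u)
    rw [Finset.filter_filter, Finset.filter_filter] at h3
    rw [exchangers]
    omega
  have hγ : ∑ N ∈ X, ((s.filter fun u => b ∈ N u ∧ a ∈ N u).card : ℝ) ≤
      2 * dc ^ 2 / s.card * X.card := by
    have := sum_codegree_mul_le hdv (N₀ := N₀) hab hs (dc := dc)
    rw [div_mul_eq_mul_div, le_div_iff₀ hs0]
    exact_mod_cast this
  have hsumR : ∀ N ∈ X, ((exchangers s a b N).card : ℝ) +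
      ((s.filter fun u => b ∈ N u ∧ a ∈ N u).card : ℝ) = k := fun N hN => by
    exact_mod_cast hsum N hN
  have hS : 0 < ∑ N ∈ X, ((exchangers s a b N).card : ℝ) := by
    have h1 := Finset.sum_congr rfl hsumR
    rw [Finset.sum_add_distrib, Finset.sum_const, nsmul_eq_mul] at h1
    have h2 : 2 * dc ^ 2 / s.card * X.card < (1 : ℝ) * X.card := by
      gcongr
      rw [div_lt_one hs0]
      exact_mod_cast hs'
    have h3 : (1 : ℝ) * X.card ≤ X.card * k := by
      rw [mul_comm]; gcongr; exact_mod_cast hk1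
    linarith
  refine ⟨hS, (abs_avg_sub_weighted_le (M := L * s.card) hXn (by exact_mod_cast hk1)
    (fun _ _ => by positivity) (fun _ _ => by positivity) hsumR hγ (by positivity) hS
    fun N hN N' hN' => hF.abs_sub_le hL hN hN').trans (le_of_eq ?_)⟩
  field_simp

/-- Switching at an exchanger passes between the two conditional families, and the same node is an
exchanger for the way back. -/
theorem switch_mem_extensions {s : Finset V} {v : V} (hv : v ∉ s) {N₁ : V → Finset C} {a b : C}
    (ha : a ∈ N₁ v) (hb : b ∉ N₁ v) {N : V → Finset C} (hN : N ∈ extensions dv dc s N₁) {u : V}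
    (hu : u ∈ exchangers s a b N) :
    switch v u a b N ∈ extensions dv dc s (Function.update N₁ v (insert b ((N₁ v).erase a))) ∧
      u ∈ exchangers s b a (switch v u a b N) := by
  rw [mem_extensions] at hN ⊢
  simp only [exchangers, Finset.mem_filter] at hu ⊢
  have hNv := hN.2 v hv
  rw [← hNv] at ha hb
  refine ⟨⟨hN.1.switch ha hb hu.2.1 hu.2.2, fun z hz => ?_⟩, hu.1, ?_, ?_⟩
  · by_cases hzv : z = v
    · subst hzv
      rw [switch_left ha hb, Function.update_self, hNv]
    · rw [switch_of_ne hzv (by rintro rfl; exact hz hu.1), Function.update_of_ne hzv, hN.2 z hz]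
  · rw [mem_switch]; simp [hu.2.2]
  · rw [mem_switch]; simp [hu.2.1]

/-- Exchanging one revealed edge for another one changes the conditional average of a Lipschitz
function by a bounded amount. -/
theorem abs_avg_sub_avg_le_of_exchange (hdv : 0 < dv) {s : Finset V} {v : V} (hv : v ∉ s)
    {N₁ : V → Finset C} {a b : C} (ha : a ∈ N₁ v) (hb : b ∉ N₁ v)
    (hs : 2 + 4 * (dv * dc) ≤ s.card) (hs' : 2 * dc ^ 2 < s.card)
    {L : ℝ} (hL : 0 ≤ L) {F : (V → Finset C) → ℝ} (hF : HammingLipschitz dv dc L F)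
    {N : V → Finset C} (hN : N ∈ extensions dv dc s N₁) (hbN : ∃ u ∈ s, b ∈ N u) :
    (extensions dv dc s (Function.update N₁ v (insert b ((N₁ v).erase a)))).Nonempty ∧
    |avg (extensions dv dc s N₁) F -
      avg (extensions dv dc s (Function.update N₁ v (insert b ((N₁ v).erase a)))) F| ≤
      (2 + 4 * dc ^ 2) * L := by
  set N₂ := Function.update N₁ v (insert b ((N₁ v).erase a)) with hN₂
  set X := extensions dv dc s N₁ with hX
  set Y := extensions dv dc s N₂ with hY
  have hab : a ≠ b := by rintro rfl; exact hb ha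
  have ha2 : a ∉ N₂ v := by simp [hN₂, hab]
  have hb2 : b ∈ N₂ v := by simp [hN₂]
  have hN₁' : N₁ = Function.update N₂ v (insert a ((N₂ v).erase b)) := by
    rw [hN₂, Function.update_idem, Function.update_self, Finset.erase_insert (by simp [hb]),
      Finset.insert_erase ha, Function.update_eq_self]
  have hXY : ∀ N ∈ X, ∀ u ∈ exchangers s a b N, switch v u a b N ∈ Y ∧
      u ∈ exchangers s b a (switch v u a b N) := fun N hN u hu =>
    switch_mem_extensions hv ha hb hN hu
  have hYX : ∀ N ∈ Y, ∀ u ∈ exchangers s b a N, switch v u a b N ∈ X ∧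
      u ∈ exchangers s a b (switch v u a b N) := fun N hN u hu => by
    have hsw : switch v u a b N = switch v u b a N := by
      funext z; simp [switch, Finset.pair_comm]
    have := switch_mem_extensions hv hb2 ha2 hN hu
    rw [← hN₁', ← hsw] at this
    exact this
  -- Pairs of a graph and an exchanger in the two families correspond bijectively. Thus both
  -- families have the same total weight, and their weighted means can be compared term by term.
  have hbij : ∀ f : (V → Finset C) → (V → Finset C) → ℝ,
      ∑ N ∈ X, ∑ u ∈ exchangers s a b N, f N (switch v u a b N) =
        ∑ N ∈ Y, ∑ u ∈ exchangers s b a N, f (switch v u a b N) N := by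
    intro f
    rw [Finset.sum_sigma', Finset.sum_sigma']
    refine Finset.sum_nbij' (fun p => ⟨switch v p.2 a b p.1, p.2⟩)
      (fun p => ⟨switch v p.2 a b p.1, p.2⟩) ?_ ?_ ?_ ?_ ?_
    · rintro ⟨N, u⟩ h
      rw [Finset.mem_sigma] at h ⊢
      exact hXY N h.1 u h.2
    · rintro ⟨N, u⟩ h
      rw [Finset.mem_sigma] at h ⊢
      exact hYX N h.1 u h.2
    · rintro ⟨N, u⟩ _; simp [switch_switch]
    · rintro ⟨N, u⟩ _; simp [switch_switch]
    · rintro ⟨N, u⟩ _; simp [switch_switch]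
  have hcount : ∑ N ∈ X, ((exchangers s a b N).card : ℝ) =
      ∑ N ∈ Y, ((exchangers s b a N).card : ℝ) := by
    simpa using hbij fun _ _ => 1
  obtain ⟨hS, hX1⟩ := abs_avg_sub_exchange_le hdv hab hs hs' hL hF hN hbN
  have hS' := hS
  rw [← hX, hcount] at hS'
  obtain ⟨N', hN', hpos⟩ := Finset.exists_ne_zero_of_sum_ne_zero hS'.ne'
  obtain ⟨u', hu'⟩ : (exchangers s b a N').Nonempty := by
    rw [Finset.nonempty_iff_ne_empty]
    rintro h
    simp [h] at hpos
  have hu'' : u' ∈ s ∧ a ∈ N' u' ∧ b ∉ N' u' := by simpa [exchangers] using hu'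
  obtain ⟨-, hY1⟩ := abs_avg_sub_exchange_le hdv hab.symm hs hs' hL hF hN' ⟨u', hu''.1, hu''.2.1⟩
  refine ⟨⟨N', hN'⟩, ?_⟩
  rw [← hX] at hX1 hS
  rw [← hY, ← hcount] at hY1
  set S := ∑ N ∈ X, ((exchangers s a b N).card : ℝ) with hSdef
  set T := ∑ N ∈ X, (exchangers s a b N).card * F N with hT
  set T' := ∑ N ∈ Y, (exchangers s b a N).card * F N with hT'
  -- Matched graphs differ in the neighbourhoods of `v` and `u` only. Adding `2 * dc ^ 2 * L` for
  -- each family gives the constant `2 + 4 * dc ^ 2`.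
  have hTT : |T / S - T' / S| ≤ 2 * L := by
    rw [← sub_div, abs_div, abs_of_pos hS, div_le_iff₀ hS]
    have e1 : T' = ∑ N ∈ X, ∑ u ∈ exchangers s a b N, F (switch v u a b N) := by
      rw [hbij fun _ N => F N]; simp [hT']
    have e2 : T = ∑ N ∈ X, ∑ u ∈ exchangers s a b N, F N := by simp [hT]
    rw [e1, e2, ← Finset.sum_sub_distrib, hSdef, Finset.mul_sum]
    refine (Finset.abs_sum_le_sum_abs _ _).trans (Finset.sum_le_sum fun N hN => ?_)
    rw [← Finset.sum_sub_distrib]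
    refine (Finset.abs_sum_le_sum_abs _ _).trans ?_
    rw [mul_comm, ← nsmul_eq_mul, ← Finset.sum_const]
    refine Finset.sum_le_sum fun u hu => ?_
    refine (hF _ _ (mem_extensions.1 hN).1 (mem_extensions.1 (hXY N hN u hu).1).1).trans ?_
    rw [mul_comm]
    gcongr
    have : (Finset.univ.filter fun z => N z ≠ switch v u a b N z) ⊆ {v, u} := by
      intro z hz
      by_contra h
      simp only [Finset.mem_insert, Finset.mem_singleton, not_or] at h
      exact (Finset.mem_filter.1 hz).2 (switch_of_ne h.1 h.2).symm
    exact_mod_cast (Finset.card_le_card this).trans Finset.card_le_two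
  have := abs_sub_le (avg X F) (T / S) (avg Y F)
  have := abs_sub_le (T / S) (T' / S) (avg Y F)
  rw [abs_sub_comm] at hY1
  linarith

/-- Revealing different neighbourhoods of `v` changes the conditional average of a Lipschitz
function by a bounded amount. -/
theorem abs_avg_update_sub_avg_update_le (hdv : 0 < dv) {s : Finset V} {v : V} (hv : v ∉ s)
    (N₀ : V → Finset C) (hs : 2 + 4 * (dv * dc) ≤ s.card) (hs' : 2 * dc ^ 2 < s.card)
    {L : ℝ} (hL : 0 ≤ L) {F : (V → Finset C) → ℝ} (hF : HammingLipschitz dv dc L F)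
    {B : Finset C} (hB : (extensions dv dc s (Function.update N₀ v B)).Nonempty) (j : ℕ) :
    ∀ {A : Finset C}, (extensions dv dc s (Function.update N₀ v A)).Nonempty →
    (A \ B).card = j →
    |avg (extensions dv dc s (Function.update N₀ v A)) F -
      avg (extensions dv dc s (Function.update N₀ v B)) F| ≤ j * ((2 + 4 * dc ^ 2) * L) := by
  have hcard : ∀ {A : Finset C}, (extensions dv dc s (Function.update N₀ v A)).Nonempty →
      A.card = dv := by
    rintro A ⟨N, hN⟩
    rw [mem_extensions] at hN
    rw [← hN.1.1 v, hN.2 v hv, Function.update_self]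
  induction j with
  | zero =>
    intro A hA hj
    have hAB : A = B := Finset.eq_of_subset_of_card_le
      (Finset.sdiff_eq_empty_iff_subset.1 (Finset.card_eq_zero.1 hj)) (by rw [hcard hA, hcard hB])
    simp [hAB]
  | succ j ih =>
    intro A hA hj
    have hBA : (B \ A).card = j + 1 := by
      rw [← hj]
      exact Finset.card_sdiff_comm (by rw [hcard hA, hcard hB])
    obtain ⟨a, ha⟩ : (A \ B).Nonempty := Finset.card_pos.1 (by omega)
    obtain ⟨b, hb⟩ : (B \ A).Nonempty := Finset.card_pos.1 (by omega)
    rw [Finset.mem_sdiff] at ha hb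
    obtain ⟨N, hN⟩ := hA
    obtain ⟨N', hN'⟩ := hB
    -- Revealing `A` uses one edge of `b` fewer than revealing `B`, so `b` must have an unrevealed
    -- neighbour in every graph of the `A`-family.
    have hbN : ∃ u ∈ s, b ∈ N u := by
      have h1 := card_filter_add_card_filter_eq hN b
      have h2 := card_filter_add_card_filter_eq hN' b
      have h3 : (sᶜ.filter fun u => b ∈ Function.update N₀ v A u) ⊂
          (sᶜ.filter fun u => b ∈ Function.update N₀ v B u) := by
        refine (Finset.ssubset_iff_of_subset fun u hu => ?_).2 ⟨v, by simp [hv, hb.1], by simp [hb.2]⟩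
        by_cases huv : u = v
        · subst huv; simp [hb.2] at hu
        · simpa [huv] using hu
      have h4 := Finset.card_lt_card h3
      obtain ⟨u, hu⟩ : (s.filter fun u => b ∈ N u).Nonempty := Finset.card_pos.1 (by omega)
      exact ⟨u, Finset.mem_filter.1 hu⟩
    obtain ⟨hne, hle⟩ := abs_avg_sub_avg_le_of_exchange hdv hv (N₁ := Function.update N₀ v A)
      (a := a) (b := b) (by simp [ha.1]) (by simp [hb.2]) hs hs' hL hF hN hbN
    rw [Function.update_self, Function.update_idem] at hne hle
    have hA' : (insert b (A.erase a) \ B).card = j := by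
      rw [Finset.insert_sdiff_of_mem _ hb.1, Finset.erase_sdiff_comm,
        Finset.card_erase_of_mem (by simp [ha]), hj]
      rfl
    have := ih hne hA'
    have h5 := abs_sub_le (avg (extensions dv dc s (Function.update N₀ v A)) F)
      (avg (extensions dv dc s (Function.update N₀ v (insert b (A.erase a)))) F)
      (avg (extensions dv dc s (Function.update N₀ v B)) F)
    push_cast
    linarith

/-- The constant in the bounded difference property of the revealing martingale. -/
def revealConst (dv dc : ℕ) : ℝ := dv * (2 + 4 * dc ^ 2) + (4 + 4 * (dv * dc) + 2 * dc ^ 2)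

/-- If `s` is large, at most `dv` exchanges lead from `A` to `B`. If `s` is small, any two graphs
concerned differ on `insert v s` only, and the Lipschitz bound suffices. The two summands of
`revealConst` cover the two cases. -/
theorem abs_avg_reveal_sub_le (hdv : 0 < dv) {s : Finset V} {v : V} (hv : v ∉ s)
    (N₀ : V → Finset C) {L : ℝ} (hL : 0 ≤ L) {F : (V → Finset C) → ℝ}
    (hF : HammingLipschitz dv dc L F) {A B : Finset C}
    (hA : (extensions dv dc s (Function.update N₀ v A)).Nonempty)
    (hB : (extensions dv dc s (Function.update N₀ v B)).Nonempty) :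
    |avg (extensions dv dc s (Function.update N₀ v A)) F -
      avg (extensions dv dc s (Function.update N₀ v B)) F| ≤ revealConst dv dc * L := by
  by_cases hs : 2 + 4 * (dv * dc) ≤ s.card ∧ 2 * dc ^ 2 < s.card
  · refine (abs_avg_update_sub_avg_update_le hdv hv N₀ hs.1 hs.2 hL hF hB _ hA rfl).trans ?_
    rw [← mul_assoc]
    refine mul_le_mul_of_nonneg_right ?_ hL
    have h1 : (A \ B).card ≤ dv := by
      refine (Finset.card_le_card Finset.sdiff_subset).trans ?_
      obtain ⟨N, hN⟩ := hA
      rw [mem_extensions] at hN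
      rw [← hN.1.1 v, hN.2 v hv, Function.update_self]
    have h2 : ((A \ B).card : ℝ) ≤ dv := by exact_mod_cast h1
    unfold revealConst
    have : ((A \ B).card : ℝ) * (2 + 4 * dc ^ 2) ≤ dv * (2 + 4 * dc ^ 2) := by gcongr
    have : (0 : ℝ) ≤ 4 + 4 * (dv * dc) + 2 * dc ^ 2 := by positivity
    linarith
  · refine abs_avg_sub_avg_le_of_forall hA hB fun N hN N' hN' => ?_
    have hext : ∀ {A : Finset C} {N}, N ∈ extensions dv dc s (Function.update N₀ v A) →
        N ∈ extensions dv dc (insert v s) N₀ := by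
      intro A N hN
      rw [mem_extensions] at hN ⊢
      refine ⟨hN.1, fun z hz => ?_⟩
      simp only [Finset.mem_insert, not_or] at hz
      rw [hN.2 z hz.2, Function.update_of_ne hz.1]
    refine (hF.abs_sub_le hL (hext hN) (hext hN')).trans ?_
    rw [mul_comm]
    refine mul_le_mul_of_nonneg_right ?_ hL
    rw [Finset.card_insert_of_notMem hv]
    have h1 : s.card + 1 ≤ 4 + 4 * (dv * dc) + 2 * dc ^ 2 := by
      by_contra h
      exact hs ⟨by omega, by omega⟩
    have h2 : ((s.card + 1 : ℕ) : ℝ) ≤ 4 + 4 * (dv * dc) + 2 * dc ^ 2 := by exact_mod_cast h1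
    have : (0 : ℝ) ≤ dv * (2 + 4 * dc ^ 2) := by positivity
    unfold revealConst
    linarith

/-- Lipschitz functions of a uniform biregular graph are sub-Gaussian. -/
theorem avg_exp_extensions_le (hdv : 0 < dv) {L : ℝ} (hL : 0 ≤ L) {F : (V → Finset C) → ℝ}
    (hF : HammingLipschitz dv dc L F) (lam : ℝ) (s : Finset V) :
    ∀ N₀ : V → Finset C, (extensions dv dc s N₀).Nonempty →
    avg (extensions dv dc s N₀) (fun N => Real.exp (lam * (F N - avg (extensions dv dc s N₀) F))) ≤
      Real.exp (lam ^ 2 * (revealConst dv dc * L) ^ 2 / 2 * s.card) := by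
  induction s using Finset.induction_on with
  | empty =>
    intro N₀ hne
    have : extensions dv dc ∅ N₀ = {N₀} := by
      refine (Finset.eq_singleton_or_nontrivial ?_).resolve_right ?_
      · obtain ⟨N, hN⟩ := hne
        have : N = N₀ := funext fun v => (mem_extensions.1 hN).2 v (by simp)
        rwa [this] at hN
      · rintro ⟨N, hN, N', hN', hNN'⟩
        exact hNN' (funext fun v => ((mem_extensions.1 hN).2 v (by simp)).trans
          ((mem_extensions.1 hN').2 v (by simp)).symm)
    rw [this]
    simp [avg]
  | insert v s hv ih =>
    intro N₀ hne
    set X := extensions dv dc (insert v s) N₀ with hX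
    let P : Finset C → Finset (V → Finset C) := fun A =>
      extensions dv dc s (Function.update N₀ v A)
    -- Revealing `v` partitions the family into the families with one unrevealed node fewer; `Y`
    -- below is the conditional mean of `F` given this partition.
    have hfib : ∀ A, X.filter (fun N => N v = A) = P A := by
      intro A
      ext N
      simp only [Finset.mem_filter, hX, P, mem_extensions, Finset.mem_insert, not_or]
      constructor
      · rintro ⟨⟨h1, h2⟩, h3⟩
        refine ⟨h1, fun z hz => ?_⟩
        by_cases hzv : z = v
        · subst hzv; simp [h3]
        · rw [Function.update_of_ne hzv, h2 z ⟨hzv, hz⟩]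
      · rintro ⟨h1, h2⟩
        refine ⟨⟨h1, fun z hz => ?_⟩, by simpa using h2 v hv⟩
        rw [h2 z hz.2, Function.update_of_ne hz.1]
    have hsum : ∀ f : (V → Finset C) → ℝ, ∑ N ∈ X, f N = ∑ A, ∑ N ∈ P A, f N := by
      intro f
      simp_rw [← hfib]
      exact (Finset.sum_fiberwise X (fun N => N v) f).symm
    have hPv : ∀ A, ∀ N ∈ P A, N v = A := by
      intro A N hN
      rw [← hfib, Finset.mem_filter] at hN
      exact hN.2
    have hPn : ∀ N ∈ X, (P (N v)).Nonempty := fun N hN => ⟨N, by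
      rw [← hfib, Finset.mem_filter]; exact ⟨hN, rfl⟩⟩
    let Y : (V → Finset C) → ℝ := fun N => avg (P (N v)) F
    have hn : (0 : ℝ) < X.card := by exact_mod_cast hne.card_pos
    have havg : avg X Y = avg X F := by
      unfold avg
      congr 1
      rw [hsum, hsum]
      refine Finset.sum_congr rfl fun A _ => ?_
      rw [← card_mul_avg (P A) F, ← nsmul_eq_mul, ← Finset.sum_const]
      exact Finset.sum_congr rfl fun N hN => by simp only [Y, hPv A N hN]
    have hY := avg_exp_le (Y := Y) (K := revealConst dv dc * L) hne (fun N hN N' hN' =>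
      abs_avg_reveal_sub_le hdv hv N₀ hL hF (hPn N hN) (hPn N' hN')) lam
    rw [havg] at hY
    set m := avg X F with hm
    set q := lam ^ 2 * (revealConst dv dc * L) ^ 2 / 2 with hq
    -- The induction hypothesis bounds the fluctuation inside each fibre, and `hY` that of the fibre
    -- means. Empty fibres contribute nothing.
    have hstep : ∑ N ∈ X, Real.exp (lam * (F N - m)) ≤
        Real.exp (q * s.card) * ∑ N ∈ X, Real.exp (lam * (Y N - m)) := by
      rw [hsum, hsum, Finset.mul_sum]
      refine Finset.sum_le_sum fun A _ => ?_
      rcases (P A).eq_empty_or_nonempty with hA | hA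
      · simp [hA]
      have h1 := ih _ hA
      rw [avg, div_le_iff₀ (by exact_mod_cast hA.card_pos)] at h1
      have h2 : ∑ N ∈ P A, Real.exp (lam * (F N - m)) =
          Real.exp (lam * (avg (P A) F - m)) *
            ∑ N ∈ P A, Real.exp (lam * (F N - avg (P A) F)) := by
        rw [Finset.mul_sum]
        refine Finset.sum_congr rfl fun N _ => ?_
        rw [← Real.exp_add]
        congr 1; ring
      have h3 : ∑ N ∈ P A, Real.exp (lam * (Y N - m)) =
          (P A).card * Real.exp (lam * (avg (P A) F - m)) := by
        rw [← nsmul_eq_mul, ← Finset.sum_const]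
        exact Finset.sum_congr rfl fun N hN => by simp only [Y, hPv A N hN]
      rw [h2, h3]
      calc _ ≤ Real.exp (lam * (avg (P A) F - m)) * (Real.exp (q * s.card) * (P A).card) := by
            gcongr
        _ = _ := by ring
    rw [avg, div_le_iff₀ hn] at hY ⊢
    refine hstep.trans ?_
    calc _ ≤ Real.exp (q * s.card) * (Real.exp q * X.card) := by
          rw [hq]
          gcongr
      _ = _ := by
          rw [Finset.card_insert_of_notMem hv, ← mul_assoc, ← Real.exp_add]
          push_cast
          congr 2; ring

end Revealing

/-! ### Sub-Gaussian bounds and McDiarmid's inequality -/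

section BoundedDifferences

variable {Ω Ω' : Type*} [MeasurableSpace Ω] [MeasurableSpace Ω']

/-- `f - 𝔼 f` has a moment generating function bounded by the Gaussian one of variance `v`. -/
def CenteredMGFBound (f : Ω → ℝ) (v : ℝ) (μ : Measure Ω) : Prop :=
  ∀ lam : ℝ, ∫ x, Real.exp (lam * (f x - ∫ y, f y ∂μ)) ∂μ ≤ Real.exp (lam ^ 2 * v / 2)

theorem integrable_of_mem_unitInterval {μ : Measure Ω} [IsProbabilityMeasure μ] {f : Ω → ℝ}
    (hf : Measurable f) (h01 : ∀ x, f x ∈ Set.Icc (0 : ℝ) 1) : Integrable f μ :=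
  Integrable.of_mem_Icc 0 1 hf.aemeasurable (Filter.Eventually.of_forall h01)

theorem integral_mem_unitInterval {μ : Measure Ω} [IsProbabilityMeasure μ] {f : Ω → ℝ}
    (hf : Measurable f) (h01 : ∀ x, f x ∈ Set.Icc (0 : ℝ) 1) : ∫ x, f x ∂μ ∈ Set.Icc (0 : ℝ) 1 := by
  refine ⟨integral_nonneg fun x => (h01 x).1, ?_⟩
  calc ∫ x, f x ∂μ ≤ ∫ _, (1 : ℝ) ∂μ :=
        integral_mono (integrable_of_mem_unitInterval hf h01) (integrable_const _) fun x => (h01 x).2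
    _ = 1 := by simp

theorem integrable_exp_of_mem_unitInterval {μ : Measure Ω} [IsProbabilityMeasure μ] {f : Ω → ℝ}
    (hf : Measurable f) (h01 : ∀ x, f x ∈ Set.Icc (0 : ℝ) 1) (lam m : ℝ) :
    Integrable (fun x => Real.exp (lam * (f x - m))) μ := by
  refine Integrable.of_mem_Icc 0 (Real.exp (|lam| * (1 + |m|)))
    (by fun_prop) (Filter.Eventually.of_forall fun x => ⟨(Real.exp_pos _).le, Real.exp_le_exp.2 ?_⟩)
  refine (le_abs_self _).trans ?_
  rw [abs_mul]
  gcongr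
  refine (abs_sub _ _).trans ?_
  gcongr
  exact abs_le.2 ⟨by linarith [(h01 x).1], (h01 x).2⟩

theorem abs_integral_sub_integral_le {μ : Measure Ω} [IsProbabilityMeasure μ] {f g : Ω → ℝ}
    (hf : Integrable f μ) (hg : Integrable g μ) {c : ℝ} (h : ∀ x, |f x - g x| ≤ c) :
    |∫ x, f x ∂μ - ∫ x, g x ∂μ| ≤ c := by
  rw [← integral_sub hf hg]
  simpa using norm_integral_le_of_norm_le_const (μ := μ) (f := fun x => f x - g x)
    (Filter.Eventually.of_forall h)

theorem measurable_integral_prod_right {ν : Measure Ω'} [IsProbabilityMeasure ν]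
    {f : Ω × Ω' → ℝ} (hf : Measurable f) : Measurable fun x => ∫ y, f (x, y) ∂ν :=
  (StronglyMeasurable.integral_prod_right (f := fun x y => f (x, y))
    (by simpa [Function.uncurry_def] using hf.stronglyMeasurable)).measurable

/-- Gaussian bounds for the conditional law and for the conditional expectation add up. -/
theorem CenteredMGFBound.prod {μ : Measure Ω} {ν : Measure Ω'} [IsProbabilityMeasure μ]
    [IsProbabilityMeasure ν] {f : Ω × Ω' → ℝ} (hf : Measurable f)
    (h01 : ∀ x, f x ∈ Set.Icc (0 : ℝ) 1) {v w : ℝ}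
    (hμ : CenteredMGFBound (fun x => ∫ y, f (x, y) ∂ν) v μ)
    (hν : ∀ x, CenteredMGFBound (fun y => f (x, y)) w ν) :
    CenteredMGFBound f (v + w) (μ.prod ν) := by
  intro lam
  have hm := integral_prod f (integrable_of_mem_unitInterval (μ := μ.prod ν) hf h01)
  rw [hm]
  have hmu := hμ lam
  set m := ∫ x, ∫ y, f (x, y) ∂ν ∂μ
  rw [integral_prod _ (integrable_exp_of_mem_unitInterval hf h01 lam m)]
  have hg := measurable_integral_prod_right (ν := ν) hf
  have hg01 : ∀ x, ∫ y, f (x, y) ∂ν ∈ Set.Icc (0 : ℝ) 1 := fun x =>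
    integral_mem_unitInterval (hf.comp measurable_prodMk_left) fun y => h01 (x, y)
  calc ∫ x, ∫ y, Real.exp (lam * (f (x, y) - m)) ∂ν ∂μ
      ≤ ∫ x, Real.exp (lam * ((∫ y, f (x, y) ∂ν) - m)) * Real.exp (lam ^ 2 * w / 2) ∂μ := by
        refine integral_mono (integrable_exp_of_mem_unitInterval hf h01 lam m).integral_prod_left
          ((integrable_exp_of_mem_unitInterval hg hg01 lam m).mul_const _) fun x => ?_
        have h1 := hν x lam
        have h2 : ∀ y, Real.exp (lam * (f (x, y) - m)) =
            Real.exp (lam * ((∫ y, f (x, y) ∂ν) - m)) *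
              Real.exp (lam * (f (x, y) - ∫ y, f (x, y) ∂ν)) := fun y => by
          rw [← Real.exp_add]; congr 1; ring
        simp_rw [h2]
        rw [integral_const_mul]
        exact mul_le_mul_of_nonneg_left h1 (Real.exp_pos _).le
    _ = (∫ x, Real.exp (lam * ((∫ y, f (x, y) ∂ν) - m)) ∂μ) * Real.exp (lam ^ 2 * w / 2) :=
        integral_mul_const _ _
    _ ≤ Real.exp (lam ^ 2 * v / 2) * Real.exp (lam ^ 2 * w / 2) := by gcongr
    _ = _ := by rw [← Real.exp_add]; congr 1; ring

/-- Hoeffding's lemma. -/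
theorem CenteredMGFBound.of_abs_sub_le {μ : Measure Ω} [IsProbabilityMeasure μ] {f : Ω → ℝ}
    (hf : Measurable f) {c : ℝ} (hc : ∀ x y, |f x - f y| ≤ c) : CenteredMGFBound f (c ^ 2) μ := by
  intro lam
  have hne : Nonempty Ω := nonempty_of_isProbabilityMeasure μ
  obtain ⟨x₀⟩ := hne
  have hc0 : 0 ≤ c := (abs_nonneg _).trans (hc x₀ x₀)
  have hbdd : BddBelow (Set.range f) := ⟨f x₀ - c, by
    rintro _ ⟨y, rfl⟩; linarith [(abs_le.1 (hc x₀ y)).2]⟩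
  have h := hasSubgaussianMGF_of_mem_Icc (μ := μ) (X := f) (a := ⨅ x, f x) (b := (⨅ x, f x) + c)
    hf.aemeasurable (Filter.Eventually.of_forall fun x => ⟨ciInf_le hbdd x, by
      have : Nonempty Ω := ⟨x₀⟩
      have : f x - c ≤ ⨅ x, f x := le_ciInf fun y => by linarith [(abs_le.1 (hc x y)).2]
      linarith⟩)
  refine (h.mgf_le lam).trans (Real.exp_le_exp.2 ?_)
  have : (((‖(⨅ x, f x) + c - ⨅ x, f x‖₊ / 2) ^ 2 : NNReal) : ℝ) = c ^ 2 / 4 := by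
    push_cast
    rw [add_sub_cancel_left, Real.norm_of_nonneg hc0]
    ring
  rw [this]
  nlinarith [mul_nonneg (sq_nonneg lam) (sq_nonneg c)]

theorem CenteredMGFBound.comp_measurePreserving {μ : Measure Ω} {ν : Measure Ω'}
    {e : Ω ≃ᵐ Ω'} (he : MeasurePreserving e μ ν) {f : Ω' → ℝ} {v : ℝ}
    (hf : CenteredMGFBound f v ν) : CenteredMGFBound (fun x => f (e x)) v μ := by
  intro lam
  rw [he.integral_comp' f, he.integral_comp' fun y => Real.exp (lam * (f y - ∫ y, f y ∂ν))]
  exact hf lam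

theorem CenteredMGFBound.mono {μ : Measure Ω} {f : Ω → ℝ} {v w : ℝ} (h : CenteredMGFBound f v μ)
    (hvw : v ≤ w) : CenteredMGFBound f w μ := fun lam =>
  (h lam).trans (Real.exp_le_exp.2 (by gcongr))

/-- Split off coordinate 0: the integral over the other coordinates moves by at most `c 0`, and each
section falls under the induction hypothesis. The bounds `c i` vary with `i` because weights of
non-edges will get the bound 0. -/
theorem CenteredMGFBound.pi_fin (ν : Measure Ω) [IsProbabilityMeasure ν] {n : ℕ} :
    ∀ {f : (Fin n → Ω) → ℝ} {c : Fin n → ℝ}, Measurable f → (∀ x, f x ∈ Set.Icc (0 : ℝ) 1) →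
    (∀ x i y, |f x - f (Function.update x i y)| ≤ c i) →
    CenteredMGFBound f (∑ i, c i ^ 2) (Measure.pi fun _ => ν) := by
  induction n with
  | zero =>
    intro f c hf _ _
    simpa using CenteredMGFBound.of_abs_sub_le (μ := Measure.pi fun _ : Fin 0 => ν) hf (c := 0)
      fun x y => by rw [Subsingleton.elim x y]; simp
  | succ n ih =>
    intro f c hf h01 hc
    have hne : Nonempty Ω := nonempty_of_isProbabilityMeasure ν
    let e := MeasurableEquiv.piFinSuccAbove (fun _ : Fin (n + 1) => Ω) 0
    have he : MeasurePreserving e (Measure.pi fun _ => ν) (ν.prod (Measure.pi fun _ => ν)) :=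
      measurePreserving_piFinSuccAbove (fun _ => ν) 0
    have hsymm : ∀ p, e.symm p = Fin.cons p.1 p.2 := fun p => by
      ext i; simp [e]
    have hf' : Measurable fun p => f (e.symm p) := hf.comp e.symm.measurable
    have hupd0 : ∀ a b z, |f (e.symm (a, z)) - f (e.symm (b, z))| ≤ c 0 := fun a b z => by
      have := hc (Fin.cons a z) 0 b
      rw [Fin.update_cons_zero] at this
      simpa [hsymm] using this
    have hupd : ∀ a z i y, |f (e.symm (a, z)) - f (e.symm (a, Function.update z i y))| ≤ c i.succ :=
      fun a z i y => by
      have := hc (Fin.cons a z) i.succ y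
      rw [← Fin.cons_update] at this
      simpa [hsymm] using this
    have hsec : ∀ a, Integrable (fun z => f (e.symm (a, z))) (Measure.pi fun _ : Fin n => ν) :=
      fun a => integrable_of_mem_unitInterval (hf'.comp measurable_prodMk_left) fun z => h01 _
    have h1 : CenteredMGFBound (fun p => f (e.symm p)) (c 0 ^ 2 + ∑ i : Fin n, c i.succ ^ 2)
        (ν.prod (Measure.pi fun _ => ν)) := by
      refine CenteredMGFBound.prod hf' (fun p => h01 _) ?_ fun a => ?_
      · exact CenteredMGFBound.of_abs_sub_le (measurable_integral_prod_right hf') fun a b =>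
          abs_integral_sub_integral_le (hsec a) (hsec b) (hupd0 a b)
      · exact ih (hf'.comp measurable_prodMk_left) (fun z => h01 _) (hupd a)
    have h2 := h1.comp_measurePreserving he
    rw [Fin.sum_univ_succ]
    simpa using h2

/-- McDiarmid's inequality, in the form of a bound for the moment generating function. -/
theorem CenteredMGFBound.pi {ι : Type*} [Fintype ι] [DecidableEq ι] (ν : Measure Ω)
    [IsProbabilityMeasure ν] {f : (ι → Ω) → ℝ} {c : ι → ℝ} (hf : Measurable f)
    (h01 : ∀ x, f x ∈ Set.Icc (0 : ℝ) 1)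
    (hc : ∀ x i y, |f x - f (Function.update x i y)| ≤ c i) :
    CenteredMGFBound f (∑ i, c i ^ 2) (Measure.pi fun _ => ν) := by
  let ε := Fintype.equivFin ι
  let e : (ι → Ω) ≃ᵐ (Fin (Fintype.card ι) → Ω) := MeasurableEquiv.arrowCongr' ε (.refl Ω)
  have he : MeasurePreserving e (Measure.pi fun _ => ν) (Measure.pi fun _ => ν) :=
    measurePreserving_arrowCongr' (fun _ => ν) (fun _ => ν) ε (.refl Ω)
      fun _ => MeasurePreserving.id _
  have hsymm : ∀ x, e.symm x = x ∘ ε := fun x => rfl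
  have h1 := CenteredMGFBound.pi_fin ν (f := fun x => f (e.symm x)) (c := fun i => c (ε.symm i))
    (hf.comp e.symm.measurable) (fun x => h01 _) (fun x i y => by
      have := hc (x ∘ ε) (ε.symm i) y
      simp only [hsymm]
      convert this using 4
      ext j
      by_cases hj : j = ε.symm i
      · subst hj; simp
      · have : ε j ≠ i := fun h => hj (by simp [← h])
        simp [hj, this])
  have h2 := h1.comp_measurePreserving he
  rw [← Equiv.sum_comp ε.symm (fun i => c i ^ 2)]
  simpa using h2

/-- The two-sided Chernoff bound. -/
theorem CenteredMGFBound.measureReal_le {μ : Measure Ω} [IsProbabilityMeasure μ] {f : Ω → ℝ}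
    (hf : Measurable f) (h01 : ∀ x, f x ∈ Set.Icc (0 : ℝ) 1) {v : ℝ} (hv : 0 ≤ v)
    (h : CenteredMGFBound f v μ) {t : ℝ} (ht : 0 ≤ t) :
    μ.real {x | |f x - ∫ y, f y ∂μ| > t} ≤ 2 * Real.exp (-t ^ 2 / (2 * v)) := by
  have hs : HasSubgaussianMGF (fun x => f x - ∫ y, f y ∂μ) v.toNNReal μ :=
    ⟨fun lam => integrable_exp_of_mem_unitInterval hf h01 lam _, fun lam => (h lam).trans
      (Real.exp_le_exp.2 (by rw [Real.coe_toNNReal v hv, mul_comm]))⟩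
  have h1 := hs.measure_ge_le ht
  have h2 := hs.neg.measure_ge_le ht
  rw [Real.coe_toNNReal v hv] at h1 h2
  rw [two_mul]
  refine le_trans ?_ (add_le_add h1 h2)
  refine (measureReal_mono ?_).trans (measureReal_union_le _ _)
  intro x hx
  rcases lt_abs.1 (show t < _ from hx) with h | h
  · exact Or.inl h.le
  · exact Or.inr h.le

end BoundedDifferences

/-! ### Locality of the message-passing rounds -/

section Locality

open Classical in
theorem docnValues_image {ι κ : Type*} (q : ι → κ) {S : Finset ι} {o : ι → ChkMsg}
    {o' : κ → ChkMsg} (ho : ∀ i ∈ S, o i = o' (q i)) :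
    docnValues (S.image q) o' = docnValues S o := by
  ext a
  simp only [docnValues, Finset.mem_image, Finset.mem_filter]
  constructor
  · rintro ⟨_, ⟨⟨i, hi, rfl⟩, h1⟩, h2⟩
    rw [← ho i hi] at h1 h2
    exact ⟨i, ⟨hi, h1⟩, h2⟩
  · rintro ⟨i, ⟨hi, h1⟩, h2⟩
    rw [ho i hi] at h1 h2
    exact ⟨q i, ⟨⟨i, hi, rfl⟩, h1⟩, h2⟩

-- Unlike the degree-one rule, the equal-check rule asks for two distinct check nodes, so the
-- relabelling has to be injective on the neighbourhood.
open Classical in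
theorem ecnValues_image {ι κ : Type*} (q : ι → κ) {S : Finset ι} (hq : Set.InjOn q S)
    {o : ι → ChkMsg} {o' : κ → ChkMsg} (ho : ∀ i ∈ S, o i = o' (q i)) :
    ecnValues (S.image q) o' = ecnValues S o := by
  ext a
  simp only [ecnValues, Finset.mem_image, Finset.mem_filter]
  constructor
  · rintro ⟨_, ⟨⟨i, hi, rfl⟩, _, ⟨j, hj, rfl⟩, hji, h1⟩, h2⟩
    rw [← ho i hi] at h1 h2
    rw [← ho j hj] at h1
    exact ⟨i, ⟨hi, j, hj, fun h => hji (by rw [h]), h1⟩, h2⟩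
  · rintro ⟨i, ⟨hi, j, hj, hji, h1⟩, h2⟩
    rw [ho i hi] at h1 h2
    rw [ho j hj] at h1
    exact ⟨q i, ⟨⟨i, hi, rfl⟩, q j, ⟨j, hj, rfl⟩, fun h => hji (hq hj hi h), h1⟩, h2⟩

open Classical in
/-- A pair of mapping functions that commutes with relabelling of the check nodes by `q`. -/
def CommutesWith {ι κ : Type*} (q : ι → κ) (Φ : Finset ι → (ι → ChkMsg) → VarMsg)
    (Φ' : Finset κ → (κ → ChkMsg) → VarMsg) : Prop :=
  ∀ (S : Finset ι) (o : ι → ChkMsg) (o' : κ → ChkMsg), Set.InjOn q S →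
    (∀ i ∈ S, o i = o' (q i)) → Φ S o = Φ' (S.image q) o'

theorem commutesWith_phiV1 {ι κ : Type*} (alg : VBAlgorithm) (q : ι → κ) :
    CommutesWith q (phiV1 alg) (phiV1 alg) := by
  intro S o o' hq ho
  cases alg <;> simp only [phiV1, docnValues_image q ho, ecnValues_image q hq ho]

theorem commutesWith_phiV2 {ι κ : Type*} (q : ι → κ) :
    CommutesWith q (phiV2 (ι := ι)) phiV2 := by
  classical
  intro S o o' hq ho
  have : (∃ i ∈ S.image q, (o' i).2 = 0) ↔ ∃ i ∈ S, (o i).2 = 0 := by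
    constructor
    · rintro ⟨_, hi, h⟩
      obtain ⟨i, hiS, rfl⟩ := Finset.mem_image.1 hi
      exact ⟨i, hiS, by rwa [ho i hiS]⟩
    · rintro ⟨i, hi, h⟩
      exact ⟨q i, Finset.mem_image_of_mem q hi, by rwa [← ho i hi]⟩
  simp only [phiV2, this]

variable {dv dc : ℕ} {V C V' C' : Type*}

open Classical in
/-- The maps `p`, `q` identify the environment of `v` in the first system with the environment of
`p v` in the second one. -/
def SameAt (p : V → V') (q : C → C') (G : BiregularGraph dv dc V C) (w : V × C → ℝ) (x : V → ℝ)
    (G' : BiregularGraph dv dc V' C') (w' : V' × C' → ℝ) (x' : V' → ℝ) (v : V) : Prop :=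
  Set.InjOn q (G.varNbrs v) ∧ G'.varNbrs (p v) = (G.varNbrs v).image q ∧
  ∀ c ∈ G.varNbrs v, Set.InjOn p (G.chkNbrs c) ∧ G'.chkNbrs (q c) = (G.chkNbrs c).image p ∧
    ∀ u ∈ G.chkNbrs c, w (u, c) = w' (p u, q c) ∧ x u = x' (p u)

section

variable {p : V → V'} {q : C → C'} {G : BiregularGraph dv dc V C} {w : V × C → ℝ} {x : V → ℝ}
  {G' : BiregularGraph dv dc V' C'} {w' : V' × C' → ℝ} {x' : V' → ℝ} {v : V}

theorem SameAt.vbRound_eq (h : SameAt p q G w x G' w' x' v)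
    {Φ : Finset C → (C → ChkMsg) → VarMsg} {Φ' : Finset C' → (C' → ChkMsg) → VarMsg}
    (hΦ : CommutesWith q Φ Φ') {s : V → VarMsg} {s' : V' → VarMsg} (hv : s v = s' (p v))
    (hs : ∀ c ∈ G.varNbrs v, ∀ u ∈ G.chkNbrs c, s u = s' (p u)) :
    vbRound Φ G w x s v = vbRound Φ' G' w' x' s' (p v) := by
  classical
  obtain ⟨hq, hN, hc⟩ := h
  have hcheck : ∀ c ∈ G.varNbrs v, checkOut G w x s c = checkOut G' w' x' s' (q c) := by
    intro c hcv
    obtain ⟨hp, hM, hd⟩ := hc c hcv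
    simp only [checkOut, phiC, measurement, hM, Finset.sum_image hp]
    refine Prod.ext ?_ ?_
    · simp only
      congr 1
      exact Finset.sum_congr rfl fun u hu => by simp only [hs c hcv u hu]
    · simp only
      congr 1
      · exact Finset.sum_congr rfl fun u hu => by rw [(hd u hu).1, (hd u hu).2]
      · exact Finset.sum_congr rfl fun u hu => by simp only [hs c hcv u hu, (hd u hu).1]
  simp only [vbRound, ← hv, hN]
  split_ifs
  · rfl
  · refine hΦ _ _ _ hq fun c hcv => ?_
    rw [hcheck c hcv, ((hc c hcv).2.2 v ((G.mem_chkNbrs v c).2 hcv)).1]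

/-- The variable nodes at distance at most two. -/
def Near (G : BiregularGraph dv dc V C) (v u : V) : Prop :=
  u = v ∨ ∃ c ∈ G.varNbrs v, u ∈ G.chkNbrs c

/-- A round reads messages up to distance two, and an iteration has two rounds; hence the nested use
of `Near` for the old messages. -/
theorem varOut_succ_eq (alg : VBAlgorithm) (ℓ : ℕ)
    (h : ∀ u, Near G v u → SameAt p q G w x G' w' x' u)
    (hs : ∀ u, Near G v u → ∀ z, Near G u z →
      varOut alg G w x ℓ z = varOut alg G' w' x' ℓ (p z)) :
    varOut alg G w x (ℓ + 1) v = varOut alg G' w' x' (ℓ + 1) (p v) := by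
  have h1 : ∀ u, Near G v u → vbRound (phiV1 alg) G w x (varOut alg G w x ℓ) u =
      vbRound (phiV1 alg) G' w' x' (varOut alg G' w' x' ℓ) (p u) := fun u hu =>
    (h u hu).vbRound_eq (commutesWith_phiV1 alg q) (hs u hu u (Or.inl rfl))
      fun c hc z hz => hs u hu z (Or.inr ⟨c, hc, hz⟩)
  exact (h v (Or.inl rfl)).vbRound_eq (commutesWith_phiV2 q) (h1 v (Or.inl rfl))
    fun c hc z hz => h1 z (Or.inr ⟨c, hc, hz⟩)

theorem varOut_eq_of_forall_sameAt (alg : VBAlgorithm)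
    (h : ∀ u, SameAt p q G w x G' w' x' u) (ℓ : ℕ) (v : V) :
    varOut alg G w x ℓ v = varOut alg G' w' x' ℓ (p v) := by
  induction ℓ generalizing v with
  | zero => rfl
  | succ ℓ ih => exact varOut_succ_eq alg ℓ (fun u _ => h u) fun _ _ z _ => ih z

end

end Locality

/-! ### How far a local change spreads -/

section Lipschitz

variable {dv dc : ℕ} {V C : Type*} [Fintype V]

/-- The number of variable nodes whose message is affected by a change near one node. -/
def spreadConst (dv dc : ℕ) : ℕ → ℕ
  | 0 => 0
  | ℓ + 1 => 1 + (1 + dv * dc) * (1 + (1 + dv * dc) * spreadConst dv dc ℓ)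

-- A new message can differ only where the environment differs, or where the node itself or one
-- sharing a check node with it had a different old message. Each old difference reaches at most `1
-- + dv * dc` nodes.
open Classical in
theorem card_vbRound_ne_le {G : BiregularGraph dv dc V C} {w : V × C → ℝ} {x : V → ℝ}
    {G' : BiregularGraph dv dc V C} {w' : V × C → ℝ} {x' : V → ℝ}
    {Φ : Finset C → (C → ChkMsg) → VarMsg} (hΦ : CommutesWith id Φ Φ) (s s' : V → VarMsg) :
    (Finset.univ.filter fun v => vbRound Φ G w x s v ≠ vbRound Φ G' w' x' s' v).card ≤
      (Finset.univ.filter fun v => ¬ SameAt id id G w x G' w' x' v).card +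
      (1 + dv * dc) * (Finset.univ.filter fun v => s v ≠ s' v).card := by
  set D := Finset.univ.filter fun v => ¬ SameAt id id G w x G' w' x' v
  set S := Finset.univ.filter fun v => s v ≠ s' v with hS
  have hsub : (Finset.univ.filter fun v => vbRound Φ G w x s v ≠ vbRound Φ G' w' x' s' v) ⊆
      D ∪ (S ∪ S.biUnion fun u => (G.varNbrs u).biUnion G.chkNbrs) := by
    intro v hv
    by_contra hcon
    simp only [Finset.mem_union, Finset.mem_biUnion, not_or, not_exists, not_and, D, hS,
      Finset.mem_filter, Finset.mem_univ, true_and, not_not] at hcon hv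
    refine hv (hcon.1.vbRound_eq hΦ hcon.2.1 fun c hc u hu => ?_)
    by_contra hne
    exact hcon.2.2 u hne c ((G.mem_chkNbrs u c).1 hu) ((G.mem_chkNbrs v c).2 hc)
  refine (Finset.card_le_card hsub).trans ((Finset.card_union_le _ _).trans ?_)
  gcongr
  refine (Finset.card_union_le _ _).trans ?_
  rw [add_mul, one_mul, mul_comm (dv * dc)]
  gcongr
  refine Finset.card_biUnion_le_card_mul _ _ _ fun u _ => ?_
  refine (Finset.card_biUnion_le_card_mul _ _ dc fun c _ => (G.card_chkNbrs c).le).trans ?_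
  rw [G.card_varNbrs]

open Classical in
theorem card_varOut_ne_le (alg : VBAlgorithm) (ℓ : ℕ) (G : BiregularGraph dv dc V C)
    (w : V × C → ℝ) (x : V → ℝ) (G' : BiregularGraph dv dc V C) (w' : V × C → ℝ) (x' : V → ℝ) :
    (Finset.univ.filter fun v => varOut alg G w x ℓ v ≠ varOut alg G' w' x' ℓ v).card ≤
      spreadConst dv dc ℓ *
        (Finset.univ.filter fun v => ¬ SameAt id id G w x G' w' x' v).card := by
  induction ℓ with
  | zero => simp [varOut]
  | succ ℓ ih =>
    have h1 := card_vbRound_ne_le (G := G) (w := w) (x := x) (G' := G') (w' := w') (x' := x')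
      (commutesWith_phiV1 alg id) (varOut alg G w x ℓ) (varOut alg G' w' x' ℓ)
    have h2 := card_vbRound_ne_le (G := G) (w := w) (x := x) (G' := G') (w' := w') (x' := x')
      (commutesWith_phiV2 id) (vbRound (phiV1 alg) G w x (varOut alg G w x ℓ))
        (vbRound (phiV1 alg) G' w' x' (varOut alg G' w' x' ℓ))
    refine h2.trans ?_
    set d := (Finset.univ.filter fun v => ¬ SameAt id id G w x G' w' x' v).card
    calc _ ≤ d + (1 + dv * dc) * (d + (1 + dv * dc) * (spreadConst dv dc ℓ * d)) := by
          gcongr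
          exact h1.trans (by gcongr)
      _ = _ := by rw [spreadConst]; ring

-- Weights sit on all pairs of nodes, but those of non-edges are never read. The value 0 for them
-- keeps the sum of squared differences proportional to the number of edges.
open Classical in
theorem card_not_sameAt_update_weight_le [DecidableEq V] [DecidableEq C] (G : BiregularGraph dv dc V C) (w : V × C → ℝ)
    (x : V → ℝ) (e : V × C) (y : ℝ) :
    (Finset.univ.filter fun v => ¬ SameAt id id G w x G (Function.update w e y) x v).card ≤
      if e.2 ∈ G.varNbrs e.1 then dc else 0 := by
  have hsub : (Finset.univ.filter fun v => ¬ SameAt id id G w x G (Function.update w e y) x v) ⊆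
      if e.2 ∈ G.varNbrs e.1 then G.chkNbrs e.2 else ∅ := by
    intro v hv
    by_contra hcon
    refine (Finset.mem_filter.1 hv).2 ⟨Function.injective_id.injOn, by simp, fun c hc =>
      ⟨Function.injective_id.injOn, by simp, fun u hu => ⟨?_, rfl⟩⟩⟩
    rw [Function.update_of_ne]
    · rfl
    · rintro rfl
      simp only [id] at hcon
      rw [if_pos ((G.mem_chkNbrs _ _).1 hu)] at hcon
      exact hcon ((G.mem_chkNbrs _ _).2 hc)
  refine (Finset.card_le_card hsub).trans ?_
  split_ifs
  · exact (G.card_chkNbrs _).le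
  · simp

open Classical in
theorem card_not_sameAt_update_signal_le [DecidableEq V] (G : BiregularGraph dv dc V C) (w : V × C → ℝ)
    (x : V → ℝ) (v : V) (y : ℝ) :
    (Finset.univ.filter fun z => ¬ SameAt id id G w x G w (Function.update x v y) z).card ≤
      dv * dc := by
  have hsub : (Finset.univ.filter fun z => ¬ SameAt id id G w x G w (Function.update x v y) z) ⊆
      (G.varNbrs v).biUnion G.chkNbrs := by
    intro z hz
    by_contra hcon
    refine (Finset.mem_filter.1 hz).2 ⟨Function.injective_id.injOn, by simp, fun c hc =>
      ⟨Function.injective_id.injOn, by simp, fun u hu => ⟨rfl, ?_⟩⟩⟩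
    rw [Function.update_of_ne]
    · rfl
    · rintro rfl
      exact hcon (Finset.mem_biUnion.2 ⟨c, (G.mem_chkNbrs _ _).1 hu, (G.mem_chkNbrs _ _).2 hc⟩)
  refine (Finset.card_le_card hsub).trans ?_
  refine (Finset.card_biUnion_le_card_mul _ _ dc fun c _ => (G.card_chkNbrs c).le).trans ?_
  rw [G.card_varNbrs]

open Classical in
theorem card_not_sameAt_graph_le [DecidableEq C] (G G' : BiregularGraph dv dc V C) (w : V × C → ℝ)
    (x : V → ℝ) :
    (Finset.univ.filter fun z => ¬ SameAt id id G w x G' w x z).card ≤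
      (1 + 2 * (dv * dc)) * (Finset.univ.filter fun v => G.varNbrs v ≠ G'.varNbrs v).card := by
  set Δ := Finset.univ.filter fun v => G.varNbrs v ≠ G'.varNbrs v with hΔ
  -- If the neighbourhood of `z` is unchanged but that of a check node `c` next to it is not, some
  -- changed `u` is adjacent to `c` in `G` or in `G'`.
  have hsub : (Finset.univ.filter fun z => ¬ SameAt id id G w x G' w x z) ⊆
      Δ ∪ Δ.biUnion fun u => (G.varNbrs u).biUnion G.chkNbrs ∪ (G'.varNbrs u).biUnion G.chkNbrs := by
    intro z hz
    by_contra hcon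
    simp only [Finset.mem_union, Finset.mem_biUnion, not_or, not_exists, not_and, hΔ,
      Finset.mem_filter, Finset.mem_univ, true_and, not_not] at hcon
    refine (Finset.mem_filter.1 hz).2 ⟨Function.injective_id.injOn, by simp [hcon.1], fun c hc =>
      ⟨Function.injective_id.injOn, ?_, fun u hu => ⟨rfl, rfl⟩⟩⟩
    rw [Finset.image_id]
    ext u
    rw [id, G.mem_chkNbrs, G'.mem_chkNbrs]
    by_cases hu : G.varNbrs u = G'.varNbrs u
    · rw [hu]
    · have hzc := (G.mem_chkNbrs z c).2 hc
      have := hcon.2 u hu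
      exact ⟨fun h => (this.2 c h hzc).elim, fun h => (this.1 c h hzc).elim⟩
  refine (Finset.card_le_card hsub).trans ((Finset.card_union_le _ _).trans ?_)
  rw [add_mul, one_mul, mul_comm (2 * (dv * dc))]
  gcongr
  refine Finset.card_biUnion_le_card_mul _ _ _ fun u _ => (Finset.card_union_le _ _).trans ?_
  rw [two_mul]
  gcongr
  · refine (Finset.card_biUnion_le_card_mul _ _ dc fun c _ => (G.card_chkNbrs c).le).trans ?_
    rw [G.card_varNbrs]
  · refine (Finset.card_biUnion_le_card_mul _ _ dc fun c _ => (G.card_chkNbrs c).le).trans ?_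
    rw [G'.card_varNbrs]

variable [Fintype C]

open Classical in
/-- As a variable node sends the same message along all its edges, the fraction of unverified
messages is the fraction of unverified variable nodes. -/
theorem unverifiedFraction_eq (hdv : 0 < dv) (alg : VBAlgorithm) (ℓ : ℕ)
    (G : BiregularGraph dv dc V C) (w : V × C → ℝ) (x : V → ℝ) :
    unverifiedFraction alg ℓ G w x =
      ((Finset.univ.filter fun v => (varOut alg G w x ℓ v).1 = false).card : ℝ) /
        Fintype.card V := by
  have key : ∀ P : V → Prop, (Finset.univ.filter fun e : V × C => e.2 ∈ G.varNbrs e.1 ∧ P e.1).card =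
      dv * (Finset.univ.filter fun v => P v).card := by
    intro P
    have : (Finset.univ.filter fun e : V × C => e.2 ∈ G.varNbrs e.1 ∧ P e.1) =
        ((Finset.univ.filter fun v => P v).sigma G.varNbrs).image fun e => (e.1, e.2) := by
      ext ⟨v, c⟩
      simp [and_comm]
    rw [this, Finset.card_image_of_injective _ (by rintro ⟨_, _⟩ ⟨_, _⟩ h; simpa using h),
      Finset.card_sigma]
    simp [G.card_varNbrs, mul_comm]
  have h1 := key fun v => (varOut alg G w x ℓ v).1 = false
  have h2 := key fun _ => True
  simp only [and_true, Finset.filter_true, Finset.card_univ] at h2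
  have hdv' : (dv : ℝ) ≠ 0 := by exact_mod_cast hdv.ne'
  have h3 : unverifiedFraction alg ℓ G w x =
      ((dv * (Finset.univ.filter fun v => (varOut alg G w x ℓ v).1 = false).card : ℕ) : ℝ) /
        ((dv * Fintype.card V : ℕ) : ℝ) := by
    refine congrArg₂ (fun a b : ℕ => (a : ℝ) / b) ?_ ?_
    · convert h1
    · convert h2
  rw [h3]
  push_cast
  rw [mul_div_mul_left _ _ hdv']

theorem unverifiedFraction_mem (alg : VBAlgorithm) (ℓ : ℕ) (G : BiregularGraph dv dc V C)
    (w : V × C → ℝ) (x : V → ℝ) : unverifiedFraction alg ℓ G w x ∈ Set.Icc (0 : ℝ) 1 := by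
  classical
  refine ⟨by unfold unverifiedFraction; positivity, div_le_one_of_le₀ ?_ (by positivity)⟩
  refine Nat.cast_le.2 (Finset.card_le_card fun e he => ?_)
  rw [Finset.mem_filter] at he ⊢
  exact ⟨he.1, he.2.1⟩

open Classical in
theorem abs_unverifiedFraction_sub_le (hdv : 0 < dv) (alg : VBAlgorithm) (ℓ : ℕ)
    (G : BiregularGraph dv dc V C) (w : V × C → ℝ) (x : V → ℝ) (G' : BiregularGraph dv dc V C)
    (w' : V × C → ℝ) (x' : V → ℝ) {d : ℕ}
    (hd : (Finset.univ.filter fun v => ¬ SameAt id id G w x G' w' x' v).card ≤ d) :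
    |unverifiedFraction alg ℓ G w x - unverifiedFraction alg ℓ G' w' x'| ≤
      spreadConst dv dc ℓ / Fintype.card V * d := by
  rw [unverifiedFraction_eq hdv, unverifiedFraction_eq hdv, ← sub_div, abs_div, Nat.abs_cast,
    div_mul_eq_mul_div]
  gcongr
  have h := (card_varOut_ne_le alg ℓ G w x G' w' x').trans (Nat.mul_le_mul_left _ hd)
  set S := Finset.univ.filter fun v => varOut alg G w x ℓ v ≠ varOut alg G' w' x' ℓ v with hS
  have hsub : ∀ {o o' : V → VarMsg}, (∀ v, o v ≠ o' v → v ∈ S) →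
      (Finset.univ.filter fun v => (o v).1 = false).card ≤
        (Finset.univ.filter fun v => (o' v).1 = false).card + S.card := by
    intro o o' hoo
    refine (Finset.card_le_card fun v hv => ?_).trans (Finset.card_union_le _ _)
    rw [Finset.mem_union, or_iff_not_imp_right]
    intro hvS
    have : o v = o' v := by by_contra hne; exact hvS (hoo v hne)
    simpa [this] using hv
  have h1 := hsub (o := varOut alg G w x ℓ) (o' := varOut alg G' w' x' ℓ) fun v hv => by simp [hS, hv]
  have h2 := hsub (o := varOut alg G' w' x' ℓ) (o' := varOut alg G w x ℓ) fun v hv => by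
    simpa [hS] using hv.symm
  have h1' := Nat.cast_le (α := ℝ) |>.2 (h1.trans (Nat.add_le_add_left h _))
  have h2' := Nat.cast_le (α := ℝ) |>.2 (h2.trans (Nat.add_le_add_left h _))
  push_cast at h1' h2'
  rw [abs_le]
  constructor <;> linarith

end Lipschitz

/-! ### Measurability of the messages -/

section Measurability

variable {Ω : Type*} [MeasurableSpace Ω]

theorem measurableSet_exists_mem_finset {ι : Type*} (S : Finset ι) {p : Ω → ι → Prop}
    (hp : ∀ i ∈ S, MeasurableSet {ω | p ω i}) : MeasurableSet {ω | ∃ i ∈ S, p ω i} := by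
  have : {ω | ∃ i ∈ S, p ω i} = ⋃ i ∈ S, {ω | p ω i} := by ext; simp
  rw [this]
  exact Finset.measurableSet_biUnion S hp

-- The candidate set is random. For each fixed set of selected indices the smallest candidate is a
-- finite infimum of measurable functions, and only finitely many selections occur.
open Classical in
theorem measurable_verifyWith_image_filter {ι : Type*} (S : Finset ι)
    {p : Ω → ι → Prop} {r : Ω → ι → ℝ} (hp : ∀ i ∈ S, MeasurableSet {ω | p ω i})
    (hr : ∀ i ∈ S, Measurable fun ω => r ω i) :
    Measurable fun ω => verifyWith ((S.filter (p ω)).image (r ω)) := by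
  have hA : ∀ A ⊆ S, Measurable fun ω => verifyWith (A.image (r ω)) := by
    intro A hAS
    rcases A.eq_empty_or_nonempty with rfl | hne
    · simp [verifyWith]
    · have : ∀ ω, verifyWith (A.image (r ω)) = (true, A.inf' hne (r ω)) := by
        intro ω
        have : (A.image (r ω)).Nonempty := hne.image _
        simp only [verifyWith, this, dif_pos, Finset.min'_eq_inf', Finset.inf'_image]
        rfl
      simp_rw [this]
      refine Measurable.prodMk measurable_const ?_
      have : Measurable (A.inf' hne fun i ω => r ω i) :=
        Finset.inf'_induction hne _ (fun _ hf _ hg => hf.inf hg) fun i hi => hr i (hAS hi)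
      convert this using 1
      ext ω
      simp
  have hSel : ∀ A ⊆ S, MeasurableSet {ω | S.filter (p ω) = A} := by
    intro A hAS
    have : {ω | S.filter (p ω) = A} = {ω | ∃ i ∈ S, ¬ (p ω i ↔ i ∈ A)}ᶜ := by
      ext ω
      simp only [Set.mem_ofPred_eq, Set.mem_compl_iff, not_exists, not_and, not_not,
        Finset.ext_iff, Finset.mem_filter]
      constructor
      · intro h i hi
        rw [← h i]; simp [hi]
      · intro h i
        constructor
        · rintro ⟨h1, h2⟩; exact (h i h1).1 h2
        · intro h1; exact ⟨hAS h1, (h i (hAS h1)).2 h1⟩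
    rw [this]
    refine (measurableSet_exists_mem_finset S fun i hi => ?_).compl
    by_cases hiA : i ∈ A
    · simp only [hiA, iff_true]
      exact (hp i hi).compl
    · simp only [hiA, iff_false, not_not]
      exact hp i hi
  intro t ht
  have : (fun ω => verifyWith ((S.filter (p ω)).image (r ω))) ⁻¹' t =
      ⋃ A ∈ S.powerset, {ω | S.filter (p ω) = A} ∩ (fun ω => verifyWith (A.image (r ω))) ⁻¹' t := by
    ext ω
    simp only [Set.mem_preimage, Set.mem_iUnion, Set.mem_inter_iff, Set.mem_ofPred_eq,
      Finset.mem_powerset, exists_prop]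
    constructor
    · intro h
      exact ⟨_, Finset.filter_subset _ _, rfl, h⟩
    · rintro ⟨A, _, rfl, h⟩
      exact h
  rw [this]
  exact Finset.measurableSet_biUnion _ fun A hAS =>
    (hSel A (Finset.mem_powerset.1 hAS)).inter (hA A (Finset.mem_powerset.1 hAS) ht)

theorem measurableSet_docnValues_nonempty {ι : Type*} (S : Finset ι) {o : Ω → ι → ChkMsg}
    (ho : ∀ i ∈ S, Measurable fun ω => o ω i) :
    MeasurableSet {ω | (docnValues S (o ω)).Nonempty} := by
  classical
  have : {ω | (docnValues S (o ω)).Nonempty} = {ω | ∃ i ∈ S, (o ω i).1 = 1} := by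
    ext ω
    simp [docnValues, Finset.Nonempty]
  rw [this]
  exact measurableSet_exists_mem_finset S fun i hi =>
    measurableSet_eq_fun (ho i hi).fst measurable_const

theorem measurable_phiV1 {ι : Type*} (alg : VBAlgorithm) (S : Finset ι)
    {o : Ω → ι → ChkMsg} (ho : ∀ i ∈ S, Measurable fun ω => o ω i) :
    Measurable fun ω => phiV1 alg S (o ω) := by
  classical
  unfold phiV1
  refine Measurable.ite (measurableSet_docnValues_nonempty S ho) ?_ ?_
  · unfold docnValues
    convert measurable_verifyWith_image_filter S (p := fun ω i => (o ω i).1 = 1)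
      (r := fun ω i => (o ω i).2)
      (fun i hi => measurableSet_eq_fun (ho i hi).fst measurable_const) fun i hi => (ho i hi).snd
  · cases alg with
    | LM => exact measurable_const
    | SBB =>
      change Measurable fun ω => verifyWith (ecnValues S (o ω))
      unfold ecnValues
      convert measurable_verifyWith_image_filter S
        (p := fun ω i => ∃ j ∈ S, j ≠ i ∧ (o ω j).2 = (o ω i).2)
        (r := fun ω i => (o ω i).2) (fun i hi => ?_) fun i hi => (ho i hi).snd
      refine measurableSet_exists_mem_finset S fun j hj => ?_
      exact (MeasurableSet.const _).inter (measurableSet_eq_fun (ho j hj).snd (ho i hi).snd)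

theorem measurable_phiV2 {ι : Type*} (S : Finset ι) {o : Ω → ι → ChkMsg}
    (ho : ∀ i ∈ S, Measurable fun ω => o ω i) : Measurable fun ω => phiV2 S (o ω) := by
  classical
  unfold phiV2
  exact Measurable.ite (measurableSet_exists_mem_finset S fun i hi =>
    measurableSet_eq_fun (ho i hi).snd measurable_const) measurable_const measurable_const

variable {dv dc : ℕ} {V C : Type*}

theorem measurable_vbRound {Φ : Finset C → (C → ChkMsg) → VarMsg}
    (hΦ : ∀ (S : Finset C) (o : Ω → C → ChkMsg), (∀ i ∈ S, Measurable fun ω => o ω i) →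
      Measurable fun ω => Φ S (o ω)) (G : BiregularGraph dv dc V C)
    {w : Ω → V × C → ℝ} {x : Ω → V → ℝ} {s : Ω → V → VarMsg}
    (hw : ∀ e, Measurable fun ω => w ω e) (hx : ∀ v, Measurable fun ω => x ω v)
    (hs : ∀ v, Measurable fun ω => s ω v) (v : V) :
    Measurable fun ω => vbRound Φ G (w ω) (x ω) (s ω) v := by
  have hst : ∀ u, MeasurableSet {ω | (s ω u).1 = true} := fun u =>
    measurableSet_eq_fun (hs u).fst measurable_const
  have hcheck : ∀ c, Measurable fun ω => checkOut G (w ω) (x ω) (s ω) c := by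
    intro c
    unfold checkOut phiC measurement
    refine Measurable.prodMk ?_ ?_
    · refine (measurable_from_top (f := fun k : ℕ => dc - k)).comp ?_
      exact Finset.measurable_fun_sum _ fun u _ =>
        Measurable.ite (hst u) measurable_const measurable_const
    · refine Measurable.sub ?_ ?_
      · exact Finset.measurable_fun_sum _ fun u _ => (hw _).mul (hx u)
      · exact Finset.measurable_fun_sum _ fun u _ =>
          Measurable.ite (hst u) ((hw _).mul (hs u).snd) measurable_const
  unfold vbRound
  refine Measurable.ite (hst v) (hs v) (hΦ _ _ fun c _ => ?_)
  exact (hcheck c).fst.prodMk ((hcheck c).snd.div (hw _))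

theorem measurable_varOut (alg : VBAlgorithm) (G : BiregularGraph dv dc V C)
    {w : Ω → V × C → ℝ} {x : Ω → V → ℝ}
    (hw : ∀ e, Measurable fun ω => w ω e) (hx : ∀ v, Measurable fun ω => x ω v) (ℓ : ℕ) (v : V) :
    Measurable fun ω => varOut alg G (w ω) (x ω) ℓ v := by
  induction ℓ generalizing v with
  | zero => exact measurable_const
  | succ ℓ ih =>
    exact measurable_vbRound (fun S _ ho => measurable_phiV2 S ho) G hw hx
      (measurable_vbRound (fun S _ ho => measurable_phiV1 alg S ho) G hw hx ih) v

theorem measurableSet_varOut_unverified (alg : VBAlgorithm) (G : BiregularGraph dv dc V C)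
    {w : Ω → V × C → ℝ} {x : Ω → V → ℝ}
    (hw : ∀ e, Measurable fun ω => w ω e) (hx : ∀ v, Measurable fun ω => x ω v) (ℓ : ℕ) (v : V) :
    MeasurableSet {ω | (varOut alg G (w ω) (x ω) ℓ v).1 = false} :=
  measurableSet_eq_fun (measurable_varOut alg G hw hx ℓ v).fst measurable_const

theorem measurable_unverifiedFraction [Fintype V] [Fintype C] (hdv : 0 < dv) (alg : VBAlgorithm)
    (G : BiregularGraph dv dc V C) {w : Ω → V × C → ℝ} {x : Ω → V → ℝ}
    (hw : ∀ e, Measurable fun ω => w ω e) (hx : ∀ v, Measurable fun ω => x ω v) (ℓ : ℕ) :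
    Measurable fun ω => unverifiedFraction alg ℓ G (w ω) (x ω) := by
  classical
  simp_rw [unverifiedFraction_eq hdv, Finset.card_filter]
  push_cast
  exact Measurable.div_const (Finset.measurable_fun_sum _ fun v _ =>
    Measurable.ite (measurableSet_varOut_unverified alg G hw hx ℓ v) measurable_const
      measurable_const) _

end Measurability

/-! ### Finite dependence of a message -/

section Dependence

variable {dv dc : ℕ} {V C : Type*}

/-- The output of a variable node depends on finitely many weights and signal elements only. -/
theorem exists_finset_dependence (G : BiregularGraph dv dc V C) (ℓ : ℕ) (v : V) :
    ∃ (B : Finset V) (E : Finset (V × C)), ∀ (alg : VBAlgorithm) (w w' : V × C → ℝ)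
      (x x' : V → ℝ), (∀ e ∈ E, w e = w' e) → (∀ u ∈ B, x u = x' u) →
      varOut alg G w x ℓ v = varOut alg G w' x' ℓ v := by
  classical
  -- Collect first the finitely many nodes whose environments matter. The set is chosen before the
  -- algorithm and the data, so the final constant depends on the degrees and `ℓ` only.
  have hT : ∃ T : Finset V, ∀ (alg : VBAlgorithm) (w w' : V × C → ℝ) (x x' : V → ℝ),
      (∀ u ∈ T, SameAt id id G w x G w' x' u) →
      varOut alg G w x ℓ v = varOut alg G w' x' ℓ v := by
    induction ℓ generalizing v with
    | zero => exact ⟨∅, fun _ _ _ _ _ _ => rfl⟩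
    | succ ℓ ih =>
      choose T hT using ih
      let near : V → Finset V := fun u => insert u ((G.varNbrs u).biUnion G.chkNbrs)
      have hnear : ∀ u z, Near G u z → z ∈ near u := by
        rintro u z (rfl | ⟨c, hc, hz⟩)
        · exact Finset.mem_insert_self _ _
        · exact Finset.mem_insert_of_mem (Finset.mem_biUnion.2 ⟨c, hc, hz⟩)
      refine ⟨near v ∪ (near v).biUnion fun u => (near u).biUnion T, fun alg w w' x x' h => ?_⟩
      refine varOut_succ_eq (p := id) (q := id) alg ℓ
        (fun u hu => h u (Finset.mem_union_left _ (hnear v u hu))) fun u hu z hz =>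
        hT z alg w w' x x' fun y hy => h y (Finset.mem_union_right _ ?_)
      exact Finset.mem_biUnion.2 ⟨u, hnear v u hu, Finset.mem_biUnion.2 ⟨z, hnear u z hz, hy⟩⟩
  obtain ⟨T, hT⟩ := hT
  let D := T.biUnion G.varNbrs
  refine ⟨D.biUnion G.chkNbrs, (D.biUnion G.chkNbrs) ×ˢ D, fun alg w w' x x' hw hx =>
    hT alg w w' x x' fun u hu => ⟨Function.injective_id.injOn, by simp, fun c hc =>
      ⟨Function.injective_id.injOn, by simp, fun z hz => ?_⟩⟩⟩
  have hcD : c ∈ D := Finset.mem_biUnion.2 ⟨u, hu, hc⟩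
  have hzB : z ∈ D.biUnion G.chkNbrs := Finset.mem_biUnion.2 ⟨c, hcD, hz⟩
  exact ⟨hw (z, c) (Finset.mem_product.2 ⟨hzB, hcD⟩), hx z hzB⟩

end Dependence

/-! ### Coverings by the infinite tree -/

section Covering

variable {dv dc : ℕ} {V C : Type*}

open Classical in
/-- `p` and `q` form a covering of the graph `G` by the infinite tree. -/
structure IsCovering (hdv : 0 < dv) (hdc : 0 < dc) (G : BiregularGraph dv dc V C)
    (p : TreeVar dv dc → V) (q : TreeCheck dv dc → C) : Prop where
  injOn_varNbrs : ∀ t, Set.InjOn q ((biregularTree dv dc hdv hdc).varNbrs t)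
  varNbrs_eq : ∀ t, G.varNbrs (p t) = ((biregularTree dv dc hdv hdc).varNbrs t).image q
  injOn_chkNbrs : ∀ c, Set.InjOn p ((biregularTree dv dc hdv hdc).chkNbrs c)
  chkNbrs_eq : ∀ c, G.chkNbrs (q c) = ((biregularTree dv dc hdv hdc).chkNbrs c).image p

theorem exists_injective_image_eq {α : Type*} [DecidableEq α] {S : Finset α} {k : ℕ}
    (h : S.card = k) :
    ∃ f : Fin k → α, Function.Injective f ∧ Finset.univ.image f = S := by
  refine ⟨fun i => (S.equivFinOfCardEq h).symm i, fun i j hij => ?_, ?_⟩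
  · exact (S.equivFinOfCardEq h).symm.injective (Subtype.ext hij)
  · ext a
    simp only [Finset.mem_image, Finset.mem_univ, true_and]
    constructor
    · rintro ⟨i, rfl⟩; exact Subtype.prop _
    · intro ha; exact ⟨S.equivFinOfCardEq h ⟨a, ha⟩, by simp⟩

/-- Local bijectivity at a non-root node: the parent goes to one neighbour of the image, and the
children enumerate the others. -/
theorem injOn_insert_image {α β : Type*} [DecidableEq α] [DecidableEq β] {k : ℕ} (g : α → β)
    (a : α) (f : Fin k → α) (S : Finset β)
    (ha : g a ∈ S) (hf : Function.Injective fun i => g (f i))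
    (hS : Finset.univ.image (fun i => g (f i)) = S.erase (g a)) :
    Set.InjOn g (insert a (Finset.univ.image f) : Finset α) ∧
      S = (insert a (Finset.univ.image f)).image g := by
  have hne : ∀ i, g (f i) ≠ g a := fun i => by
    have : g (f i) ∈ S.erase (g a) := by
      rw [← hS]; exact Finset.mem_image_of_mem _ (Finset.mem_univ i)
    exact (Finset.mem_erase.1 this).1
  constructor
  · intro x hx y hy hxy
    simp only [Finset.coe_insert, Finset.coe_image, Finset.coe_univ, Set.image_univ,
      Set.mem_insert_iff, Set.mem_range] at hx hy
    rcases hx with rfl | ⟨i, rfl⟩ <;> rcases hy with rfl | ⟨j, rfl⟩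
    · rfl
    · exact (hne j hxy.symm).elim
    · exact (hne i hxy).elim
    · rw [hf hxy]
  · rw [Finset.image_insert, Finset.image_image]
    change S = insert (g a) (Finset.univ.image fun i => g (f i))
    rw [hS, Finset.insert_erase ha]

open Classical in
theorem biregularTree_varNbrs_root (hdv : 0 < dv) (hdc : 0 < dc) :
    (biregularTree dv dc hdv hdc).varNbrs .root = Finset.univ.image TreeCheck.top := by
  ext; simp [biregularTree, TreeVar.nbrs]

open Classical in
theorem biregularTree_varNbrs_child (hdv : 0 < dv) (hdc : 0 < dc) (c : TreeCheck dv dc)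
    (j : Fin (dc - 1)) : (biregularTree dv dc hdv hdc).varNbrs (.child c j) =
      insert c (Finset.univ.image (TreeCheck.deeper c j)) := by
  ext; simp [biregularTree, TreeVar.nbrs]

open Classical in
theorem biregularTree_chkNbrs (hdv : 0 < dv) (hdc : 0 < dc) (c : TreeCheck dv dc) :
    (biregularTree dv dc hdv hdc).chkNbrs c =
      insert c.parent (Finset.univ.image (TreeVar.child c)) := by
  ext; simp [biregularTree, TreeCheck.nbrs]

/-- Every biregular graph is covered by the infinite tree. -/
theorem exists_isCovering (hdv : 0 < dv) (hdc : 0 < dc) (G : BiregularGraph dv dc V C) (v : V) :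
    ∃ p q, IsCovering hdv hdc G p q ∧ p .root = v := by
  classical
  obtain ⟨e0, he0, he0'⟩ := exists_injective_image_eq (G.card_varNbrs v)
  -- Enumerations are chosen for all pairs, with a constant map for non-adjacent ones, so that the
  -- recursion below carries no proofs; adjacency is established afterwards in `hinv`.
  have hV : ∀ (c : C) (u : V), ∃ f : Fin (dc - 1) → V, u ∈ G.chkNbrs c →
      Function.Injective f ∧ Finset.univ.image f = (G.chkNbrs c).erase u := by
    intro c u
    by_cases hu : u ∈ G.chkNbrs c
    · obtain ⟨f, hf⟩ := exists_injective_image_eq (S := (G.chkNbrs c).erase u) (k := dc - 1)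
        (by rw [Finset.card_erase_of_mem hu, G.card_chkNbrs])
      exact ⟨f, fun _ => hf⟩
    · exact ⟨fun _ => u, fun h => (hu h).elim⟩
  have hC : ∀ (u : V) (c : C), ∃ f : Fin (dv - 1) → C, c ∈ G.varNbrs u →
      Function.Injective f ∧ Finset.univ.image f = (G.varNbrs u).erase c := by
    intro u c
    by_cases hc : c ∈ G.varNbrs u
    · obtain ⟨f, hf⟩ := exists_injective_image_eq (S := (G.varNbrs u).erase c) (k := dv - 1)
        (by rw [Finset.card_erase_of_mem hc, G.card_varNbrs])
      exact ⟨f, fun _ => hf⟩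
    · exact ⟨fun _ => c, fun h => (hc h).elim⟩
  choose eV heV using hV
  choose eC heC using hC
  -- The recursion carries the image of a check node together with that of its parent, which has to
  -- be skipped when the children are enumerated.
  let F : TreeCheck dv dc → C × V := fun c => TreeCheck.rec (fun i => (e0 i, v))
    (fun _ j i r => (eC (eV r.1 r.2 j) r.1 i, eV r.1 r.2 j)) c
  have hF1 : ∀ i, F (.top i) = (e0 i, v) := fun i => rfl
  have hF2 : ∀ c j i, F (.deeper c j i) =
      (eC (eV (F c).1 (F c).2 j) (F c).1 i, eV (F c).1 (F c).2 j) := fun c j i => rfl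
  let q : TreeCheck dv dc → C := fun c => (F c).1
  let p : TreeVar dv dc → V := fun t => match t with
    | .root => v
    | .child c j => eV (F c).1 (F c).2 j
  have hpar : ∀ c, (F c).2 = p c.parent := by
    intro c
    cases c <;> rfl
  have hmemV : ∀ c, (F c).2 ∈ G.chkNbrs (F c).1 → ∀ j, eV (F c).1 (F c).2 j ∈
      (G.chkNbrs (F c).1).erase (F c).2 := by
    intro c hc j
    rw [← (heV _ _ hc).2]
    exact Finset.mem_image_of_mem _ (Finset.mem_univ j)
  have hinv : ∀ c, (F c).2 ∈ G.chkNbrs (F c).1 := by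
    intro c
    induction c with
    | top i =>
      rw [hF1, G.mem_chkNbrs, ← he0']
      exact Finset.mem_image_of_mem _ (Finset.mem_univ i)
    | deeper c j i ih =>
      have h1 := (G.mem_chkNbrs _ _).1 (Finset.mem_of_mem_erase (hmemV c ih j))
      rw [hF2, G.mem_chkNbrs]
      refine Finset.mem_of_mem_erase (a := (F c).1) ?_
      rw [← (heC _ _ h1).2]
      exact Finset.mem_image_of_mem _ (Finset.mem_univ i)
  have hchild : ∀ c j, (F c).1 ∈ G.varNbrs (p (.child c j)) := fun c j =>
    (G.mem_chkNbrs _ _).1 (Finset.mem_of_mem_erase (hmemV c (hinv c) j))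
  have hvar : ∀ t : TreeVar dv dc, Set.InjOn q ((biregularTree dv dc hdv hdc).varNbrs t) ∧
      G.varNbrs (p t) = ((biregularTree dv dc hdv hdc).varNbrs t).image q := by
    intro t
    cases t with
    | root =>
      rw [biregularTree_varNbrs_root]
      constructor
      · intro x hx y hy hxy
        simp only [Finset.coe_image, Finset.coe_univ, Set.image_univ, Set.mem_range] at hx hy
        obtain ⟨i, rfl⟩ := hx
        obtain ⟨j, rfl⟩ := hy
        rw [he0 hxy]
      · rw [Finset.image_image, ← he0']
        rfl
    | child c j =>
      have h := heC _ _ (hchild c j)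
      rw [biregularTree_varNbrs_child]
      exact injOn_insert_image q c (TreeCheck.deeper c j) (G.varNbrs (p (.child c j))) (hchild c j)
        h.1 h.2
  have hchk : ∀ c : TreeCheck dv dc, Set.InjOn p ((biregularTree dv dc hdv hdc).chkNbrs c) ∧
      G.chkNbrs (q c) = ((biregularTree dv dc hdv hdc).chkNbrs c).image p := by
    intro c
    have h := heV _ _ (hinv c)
    have hmem := hinv c
    rw [biregularTree_chkNbrs]
    refine injOn_insert_image p c.parent (TreeVar.child c) (G.chkNbrs (q c)) ?_ ?_ ?_
    · rw [← hpar]; exact hmem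
    · exact h.1
    · rw [← hpar]; exact h.2
  exact ⟨p, q, ⟨fun t => (hvar t).1, fun t => (hvar t).2, fun c => (hchk c).1,
    fun c => (hchk c).2⟩, rfl⟩

variable {hdv : 0 < dv} {hdc : 0 < dc} {G : BiregularGraph dv dc V C}
  {p : TreeVar dv dc → V} {q : TreeCheck dv dc → C}

/-- This holds for every covering, injective or not. Injectivity matters only for the law: without
it the pulled-back data are no longer independent. -/
theorem IsCovering.varOut_eq (h : IsCovering hdv hdc G p q) (alg : VBAlgorithm) (ℓ : ℕ)
    (w : V × C → ℝ) (x : V → ℝ) (t : TreeVar dv dc) :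
    varOut alg (biregularTree dv dc hdv hdc) (fun e => w (p e.1, q e.2)) (fun u => x (p u)) ℓ t =
      varOut alg G w x ℓ (p t) :=
  varOut_eq_of_forall_sameAt alg (fun u => ⟨h.injOn_varNbrs u, by classical convert h.varNbrs_eq u,
    fun c _ => ⟨h.injOn_chkNbrs c, by classical convert h.chkNbrs_eq c, fun _ _ => ⟨rfl, rfl⟩⟩⟩) ℓ t

theorem measurable_reindex {V C I J : Type*} (p : J → V) (q : I → V × C) :
    Measurable (Prod.map (fun (w : V × C → ℝ) (e : I) => w (q e))
      fun (x : V → ℝ) (u : J) => x (p u)) :=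
  Measurable.prodMap (by fun_prop) (by fun_prop)

theorem map_dataLaw_reindex {V C I J : Type*} {p : J → V} {q : I → V × C}
    (hp : Function.Injective p) (hq : Function.Injective q) (f g : Measure ℝ)
    [IsProbabilityMeasure f] [IsProbabilityMeasure g] (α : unitInterval) :
    (dataLaw V C f g α).map (Prod.map (fun w (e : I) => w (q e)) fun x (u : J) => x (p u)) =
      (Measure.infinitePi fun _ : I => f).prod (Measure.infinitePi fun _ : J => signalLaw g α) := by
  rw [dataLaw, ← Measure.map_prod_map _ _ (by fun_prop) (by fun_prop),
    Measure.map_infinitePi_infinitePi_of_inj (P := fun _ : V × C => f) hq,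
    Measure.map_infinitePi_infinitePi_of_inj (P := fun _ : V => signalLaw g α) hp]

/-- If the covering is injective on the part of the tree that matters, then the root behaves as in
the tree. -/
theorem IsCovering.measureReal_unverified_eq (h : IsCovering hdv hdc G p q) {alg : VBAlgorithm}
    {ℓ : ℕ} {B : Finset (TreeVar dv dc)} {E : Finset (TreeVar dv dc × TreeCheck dv dc)}
    (hdep : ∀ (w w' : TreeVar dv dc × TreeCheck dv dc → ℝ) (x x' : TreeVar dv dc → ℝ),
      (∀ e ∈ E, w e = w' e) → (∀ u ∈ B, x u = x' u) →
      varOut alg (biregularTree dv dc hdv hdc) w x ℓ .root =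
        varOut alg (biregularTree dv dc hdv hdc) w' x' ℓ .root)
    (hB : Set.InjOn p B) (hE : Set.InjOn (fun e : TreeVar dv dc × TreeCheck dv dc =>
      (p e.1, q e.2)) E) (f g : Measure ℝ) [IsProbabilityMeasure f] [IsProbabilityMeasure g]
    (α : unitInterval) :
    (dataLaw V C f g α).real {ω | (varOut alg G ω.1 ω.2 ℓ (p .root)).1 = false} =
      treeUnverified dv dc hdv hdc alg ℓ f g α := by
  classical
  let T := biregularTree dv dc hdv hdc
  -- Both events are preimages of one event `A` in finitely many coordinates. The value 0 outside
  -- `E` and `B` is immaterial by `hdep`, and injective reindexings push both data laws to the same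
  -- product.
  let ext1 : (E → ℝ) → (TreeVar dv dc × TreeCheck dv dc → ℝ) := fun z e =>
    if he : e ∈ E then z ⟨e, he⟩ else 0
  let ext2 : (B → ℝ) → (TreeVar dv dc → ℝ) := fun z u => if hu : u ∈ B then z ⟨u, hu⟩ else 0
  let A : Set ((E → ℝ) × (B → ℝ)) := {z | (varOut alg T (ext1 z.1) (ext2 z.2) ℓ .root).1 = false}
  have hA : MeasurableSet A := by
    refine measurableSet_varOut_unverified alg T (w := fun z : (E → ℝ) × (B → ℝ) => ext1 z.1)
      (x := fun z => ext2 z.2) (fun e => ?_) (fun u => ?_) ℓ .root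
    · by_cases he : e ∈ E
      · simp only [ext1, he, dif_pos]; fun_prop
      · simp only [ext1, he, dif_neg, not_false_iff]; fun_prop
    · by_cases hu : u ∈ B
      · simp only [ext2, hu, dif_pos]; fun_prop
      · simp only [ext2, hu, dif_neg, not_false_iff]; fun_prop
  have h1 : {ω : (V × C → ℝ) × (V → ℝ) | (varOut alg G ω.1 ω.2 ℓ (p .root)).1 = false} =
      Prod.map (fun w (e : E) => w (p e.1.1, q e.1.2)) (fun x (u : B) => x (p u)) ⁻¹' A := by
    ext ω
    have := hdep (fun e => ω.1 (p e.1, q e.2)) (ext1 fun e => ω.1 (p e.1.1, q e.1.2))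
      (fun u => ω.2 (p u)) (ext2 fun u => ω.2 (p u)) (fun e he => by simp [ext1, he])
      (fun u hu => by simp [ext2, hu])
    rw [Set.mem_ofPred_eq, ← h.varOut_eq, this]
    rfl
  have h2 : {ω : (TreeVar dv dc × TreeCheck dv dc → ℝ) × (TreeVar dv dc → ℝ) |
      (varOut alg T ω.1 ω.2 ℓ .root).1 = false} =
      Prod.map (fun w (e : E) => w e) (fun x (u : B) => x u) ⁻¹' A := by
    ext ω
    have := hdep ω.1 (ext1 fun e => ω.1 e) ω.2 (ext2 fun u => ω.2 u)
      (fun e he => by simp [ext1, he]) (fun u hu => by simp [ext2, hu])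
    rw [Set.mem_ofPred_eq, this]
    rfl
  rw [treeUnverified, h1, h2,
    ← map_measureReal_apply (measurable_reindex (fun u : B => p u)
      (fun e : E => (p e.1.1, q e.1.2))) hA,
    ← map_measureReal_apply (measurable_reindex (fun u : B => u.1) (fun e : E => e.1)) hA,
    map_dataLaw_reindex (p := fun u : B => p u) (q := fun e : E => (p e.1.1, q e.1.2))
      (fun a b hab => Subtype.ext (hB a.2 b.2 hab)) (fun a b hab => Subtype.ext (hE a.2 b.2 hab)),
    map_dataLaw_reindex Subtype.val_injective Subtype.val_injective]

end Covering

/-! ### Tree images closed by an extra edge -/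

section Subtrees

variable {V C : Type*}

/-- The edge `e` joins the nodes `y` and `z`. -/
def Joins (e : V × C) (y z : V ⊕ C) : Prop :=
  (y = .inl e.1 ∧ z = .inr e.2) ∨ (y = .inr e.2 ∧ z = .inl e.1)

theorem Joins.unique {e e' : V × C} {y z : V ⊕ C} (h : Joins e y z) (h' : Joins e' y z) :
    e = e' := by
  obtain ⟨a, b⟩ := e
  obtain ⟨a', b'⟩ := e'
  unfold Joins at h h'
  grind

theorem Joins.eq_or_eq {e : V × C} {y z y' z' : V ⊕ C} (h : Joins e y z) (h' : Joins e y' z') :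
    (y = y' ∧ z = z') ∨ (y = z' ∧ z = y') := by
  unfold Joins at h h'
  grind

variable {T : Type*} [Fintype T] [Fintype V] [Fintype C]

open Classical in
/-- The edges of the image under `ψ` of the part `P` of a tree with root `r` and parent map
`par`. -/
def imageEdges (r : T) (par : T → T) (P : Finset T) (ψ : T → V ⊕ C) : Finset (V × C) :=
  Finset.univ.filter fun e => ∃ s ∈ P, s ≠ r ∧ Joins e (ψ (par s)) (ψ s)

/-- `ψ` maps the part `P` of the tree to a graph in which adjacent nodes are joined by an edge. -/
def IsTreeMap (r : T) (par : T → T) (v : V) (P : Finset T) (ψ : T → V ⊕ C) : Prop :=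
  ψ r = .inl v ∧ (∀ s ∉ P, ψ s = .inl v) ∧
    ∀ s ∈ P, s ≠ r → ∃ e, Joins e (ψ (par s)) (ψ s)

theorem card_imageEdges_le (r : T) (par : T → T) (P : Finset T) (ψ : T → V ⊕ C) :
    (imageEdges r par P ψ).card ≤ Fintype.card T := by
  classical
  have hsub : imageEdges r par P ψ ⊆
      Finset.univ.biUnion fun s => Finset.univ.filter fun e => Joins e (ψ (par s)) (ψ s) := by
    intro e he
    obtain ⟨s, _, _, hs⟩ := (Finset.mem_filter.1 he).2
    exact Finset.mem_biUnion.2 ⟨s, Finset.mem_univ _, by simpa using hs⟩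
  refine (Finset.card_le_card hsub).trans ((Finset.card_biUnion_le_card_mul _ _ 1 fun s _ => ?_).trans
    (by simp))
  refine Finset.card_le_one.2 fun e he e' he' => ?_
  exact Joins.unique (Finset.mem_filter.1 he).2 (Finset.mem_filter.1 he').2

variable {dv dc : ℕ} [DecidableEq V] [DecidableEq C]

/-- Labels for the neighbours of a node, from one alphabet for variable and check nodes alike; they
encode walks in the graph. -/
theorem exists_index (hdv : 0 < dv) {N : V → Finset C} (hN : IsBiregular dv dc N) (y : V ⊕ C) :
    ∃ f : V ⊕ C → Fin (dv + dc), ∀ z z', (∃ e : V × C, e.2 ∈ N e.1 ∧ Joins e y z) →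
      (∃ e : V × C, e.2 ∈ N e.1 ∧ Joins e y z') → f z = f z' → z = z' := by
  classical
  have hD : 0 < dv + dc := by omega
  let S : Finset (V ⊕ C) := Finset.univ.filter fun z => ∃ e : V × C, e.2 ∈ N e.1 ∧ Joins e y z
  have hS : S.card ≤ dv + dc := by
    cases y with
    | inl u =>
      have : S ⊆ (N u).image Sum.inr := by
        intro z hz
        obtain ⟨e, he, hj⟩ := (Finset.mem_filter.1 hz).2
        unfold Joins at hj
        rw [Finset.mem_image]
        rcases hj with ⟨h1, h2⟩ | ⟨h1, _⟩
        · exact ⟨e.2, by rw [Sum.inl.inj h1]; exact he, h2.symm⟩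
        · simp at h1
      refine (Finset.card_le_card this).trans (Finset.card_image_le.trans ?_)
      rw [hN.1]; omega
    | inr c =>
      have : S ⊆ (Finset.univ.filter fun u => c ∈ N u).image Sum.inl := by
        intro z hz
        obtain ⟨e, he, hj⟩ := (Finset.mem_filter.1 hz).2
        unfold Joins at hj
        rw [Finset.mem_image]
        rcases hj with ⟨h1, _⟩ | ⟨h1, h2⟩
        · simp at h1
        · exact ⟨e.1, by rw [Sum.inr.inj h1]; simpa using he, h2.symm⟩
      refine (Finset.card_le_card this).trans (Finset.card_image_le.trans ?_)
      rw [hN.2]; omega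
  obtain ⟨ι⟩ := Function.Embedding.nonempty_of_card_le (α := S) (β := Fin (dv + dc)) (by simpa using hS)
  refine ⟨fun z => if hz : z ∈ S then ι ⟨z, hz⟩ else ⟨0, hD⟩, fun z z' hz hz' h => ?_⟩
  have hz1 : z ∈ S := by simpa [S] using hz
  have hz2 : z' ∈ S := by simpa [S] using hz'
  simp only [hz1, hz2, dif_pos] at h
  simpa using ι.injective h

open Classical in
/-- The number of rooted images of a tree in a graph of bounded degree is bounded. -/
theorem card_treeMaps_le (hdv : 0 < dv) {r : T} {par : T → T} {depth : T → ℕ}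
    (hdepth : ∀ s, s ≠ r → depth (par s) < depth s) (v : V) (P : Finset T) {N : V → Finset C}
    (hN : IsBiregular dv dc N) :
    (Finset.univ.filter fun ψ : T → V ⊕ C => IsTreeMap r par v P ψ ∧
      ∀ e ∈ imageEdges r par P ψ, e.2 ∈ N e.1).card ≤ (dv + dc) ^ Fintype.card T := by
  choose f hf using exists_index (dc := dc) hdv hN
  have hcard : (dv + dc) ^ Fintype.card T = (Finset.univ : Finset (T → Fin (dv + dc))).card := by
    simp
  rw [hcard]
  -- A tree map is coded by the label of each image among the neighbours of its parent's image, and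
  -- decoded by induction on the depth. Off `P` it is constant, so no choices arise there.
  refine Finset.card_le_card_of_injOn (fun ψ s => f (ψ (par s)) (ψ s)) (by simp) ?_
  intro ψ hψ ψ' hψ' h
  simp only [Finset.coe_filter, Finset.mem_univ, true_and, Set.mem_ofPred_eq] at hψ hψ'
  have key : ∀ k s, depth s = k → ψ s = ψ' s := by
    intro k
    induction k using Nat.strong_induction_on with
    | _ k ih =>
      intro s hs
      by_cases hsr : s = r
      · rw [hsr, hψ.1.1, hψ'.1.1]
      by_cases hsP : s ∈ P
      · have hpar := ih _ (hs ▸ hdepth s hsr) (par s) rfl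
        have hs' := congrFun h s
        simp only at hs'
        rw [← hpar] at hs'
        obtain ⟨e, he⟩ := hψ.1.2.2 s hsP hsr
        obtain ⟨e', he'⟩ := hψ'.1.2.2 s hsP hsr
        have hm := hψ.2 e (Finset.mem_filter.2 ⟨Finset.mem_univ _, s, hsP, hsr, he⟩)
        have hm' := hψ'.2 e' (Finset.mem_filter.2 ⟨Finset.mem_univ _, s, hsP, hsr, he'⟩)
        rw [← hpar] at he'
        exact hf _ _ _ ⟨e, hm, he⟩ ⟨e', hm', he'⟩ hs'
      · rw [hψ.1.2.1 s hsP, hψ'.1.2.1 s hsP]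
  exact funext fun s => key _ s rfl

/-- The graph contains an image of `P` together with one more edge that joins the images of `s₀`
and `t`. -/
def ClosesAt (r : T) (par : T → T) (v : V) (P : Finset T) (s₀ t : T) (N : V → Finset C) : Prop :=
  ∃ ψ : T → V ⊕ C, IsTreeMap r par v P ψ ∧ (∀ e ∈ imageEdges r par P ψ, e.2 ∈ N e.1) ∧
    ∃ e : V × C, e ∉ imageEdges r par P ψ ∧ Joins e (ψ s₀) (ψ t) ∧ e.2 ∈ N e.1

-- A union bound over tree maps `ψ`: the switching estimate makes the closing edge cost a factor
-- `O(1/n)` given the image of `ψ`. The hypothesis `hn` lets the error term be absorbed into half of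
-- the left side.
open Classical in
theorem card_closesAt_mul_le (hdv : 0 < dv) {r : T} {par : T → T} {depth : T → ℕ}
    (hdepth : ∀ s, s ≠ r → depth (par s) < depth s)
    (hn : 2 * (Fintype.card T + 2 * (dv * dc)) ≤ Fintype.card V * dv) (v : V) (P : Finset T)
    (s₀ t : T) (N₀ : V → Finset C) :
    ((extensions dv dc Finset.univ N₀).filter (ClosesAt r par v P s₀ t)).card * Fintype.card V ≤
      2 * dc * (dv + dc) ^ Fintype.card T * (extensions dv dc Finset.univ N₀).card := by
  set X := extensions dv dc Finset.univ N₀ with hX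
  let H : (T → V ⊕ C) → Finset (V × C) := imageEdges r par P
  let Ψ : Finset (T → V ⊕ C) := Finset.univ.filter (IsTreeMap r par v P)
  let Z : (T → V ⊕ C) → Finset (V × C) := fun ψ =>
    Finset.univ.filter fun e => e ∉ H ψ ∧ Joins e (ψ s₀) (ψ t)
  have hsub : X.filter (ClosesAt r par v P s₀ t) ⊆
      Ψ.biUnion fun ψ => (Z ψ).biUnion fun e => containing X (insert e (H ψ)) := by
    intro N hN
    obtain ⟨hNX, ψ, h1, h2, e, h3, h4, h5⟩ := Finset.mem_filter.1 hN
    refine Finset.mem_biUnion.2 ⟨ψ, by simpa [Ψ] using h1, Finset.mem_biUnion.2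
      ⟨e, by simpa [Z] using ⟨h3, h4⟩, mem_containing.2 ⟨hNX, ?_⟩⟩⟩
    intro e' he'
    rcases Finset.mem_insert.1 he' with rfl | he'
    · exact h5
    · exact h2 e' he'
  have hstep : ∀ ψ, ∀ e ∈ Z ψ, (containing X (insert e (H ψ))).card * Fintype.card V ≤
      2 * dc * (containing X (H ψ)).card := by
    rintro ψ ⟨a, b⟩ he
    have h := card_containing_insert_mul_le (dv := dv) (dc := dc) Finset.univ N₀ (H ψ)
      (Finset.mem_univ a) (c := b) (Finset.mem_filter.1 he).2.1
    rw [← hX, Finset.card_univ] at h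
    have hH : (H ψ).card ≤ Fintype.card T := card_imageEdges_le r par P ψ
    set x := (containing X (insert (a, b) (H ψ))).card
    set y := (containing X (H ψ)).card
    have h3 : x * (2 * ((H ψ).card + 2 * (dv * dc))) ≤ x * (Fintype.card V * dv) :=
      Nat.mul_le_mul_left _ (by omega)
    refine Nat.le_of_mul_le_mul_right ?_ hdv
    nlinarith
  have hZ : ∀ ψ, (Z ψ).card ≤ 1 := fun ψ => Finset.card_le_one.2 fun e he e' he' =>
    Joins.unique (Finset.mem_filter.1 he).2.2 (Finset.mem_filter.1 he').2.2
  calc _ ≤ (∑ ψ ∈ Ψ, ∑ e ∈ Z ψ, (containing X (insert e (H ψ))).card) * Fintype.card V :=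
        Nat.mul_le_mul_right _ ((Finset.card_le_card hsub).trans (Finset.card_biUnion_le.trans
          (Finset.sum_le_sum fun ψ _ => Finset.card_biUnion_le)))
    _ = ∑ ψ ∈ Ψ, ∑ e ∈ Z ψ, (containing X (insert e (H ψ))).card * Fintype.card V := by
        simp_rw [Finset.sum_mul]
    _ ≤ ∑ ψ ∈ Ψ, ∑ e ∈ Z ψ, 2 * dc * (containing X (H ψ)).card :=
        Finset.sum_le_sum fun ψ _ => Finset.sum_le_sum (hstep ψ)
    _ ≤ ∑ ψ ∈ Ψ, 2 * dc * (containing X (H ψ)).card := by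
        refine Finset.sum_le_sum fun ψ _ => ?_
        rw [Finset.sum_const, smul_eq_mul]
        exact (Nat.mul_le_mul_right _ (hZ ψ)).trans (by rw [one_mul])
    -- Exchanging the sums avoids counting all maps `ψ`, whose number grows with `n`: only those
    -- whose image lies in a given graph matter.
    _ = 2 * dc * ∑ N ∈ X, (Ψ.filter fun ψ => ∀ e ∈ H ψ, e.2 ∈ N e.1).card := by
        rw [← Finset.mul_sum]
        congr 1
        simp_rw [containing, Finset.card_filter]
        rw [Finset.sum_comm]
    _ ≤ 2 * dc * ∑ N ∈ X, (dv + dc) ^ Fintype.card T := by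
        refine Nat.mul_le_mul_left _ (Finset.sum_le_sum fun N hN => ?_)
        rw [Finset.filter_filter]
        exact card_treeMaps_le hdv hdepth v P (mem_extensions.1 hN).1
    _ = _ := by
        rw [Finset.sum_const, smul_eq_mul]; ring

/-- A locally injective map of a tree to a graph without closing edges is injective. -/
theorem injective_of_not_closesAt {r : T} {par : T → T} {depth : T → ℕ}
    (hdepth : ∀ s, s ≠ r → depth (par s) < depth s) {v : V} {N : V → Finset C}
    {φ : T → V ⊕ C} (hr : φ r = .inl v)
    (hadj : ∀ s, s ≠ r → ∃ e : V × C, e.2 ∈ N e.1 ∧ Joins e (φ (par s)) (φ s))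
    (hsib : ∀ a b, a ≠ r → b ≠ r → par a = par b → φ a = φ b → a = b)
    (hgp : ∀ a, a ≠ r → par a ≠ r → φ (par (par a)) ≠ φ a)
    (hN : ∀ P s₀ t, ¬ ClosesAt r par v P s₀ t N) : Function.Injective φ := by
  classical
  -- Take a largest subtree `P` on which `φ` is injective. If it is proper, a shallowest node `t'`
  -- outside it has its parent in `P` and, by maximality, shares its image with some `t ∈ P`.
  let Q : Finset (Finset T) := Finset.univ.filter fun P =>
    r ∈ P ∧ (∀ s ∈ P, s ≠ r → par s ∈ P) ∧ Set.InjOn φ P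
  have hQ : Q.Nonempty := ⟨{r}, by simp [Q]⟩
  obtain ⟨P, hPQ, hmax⟩ := Finset.exists_max_image Q Finset.card hQ
  obtain ⟨hrP, hclosed, hinj⟩ := (Finset.mem_filter.1 hPQ).2
  by_cases hPu : P = Finset.univ
  · rw [hPu, Finset.coe_univ, Set.injOn_univ] at hinj
    exact hinj
  exfalso
  have hne : Pᶜ.Nonempty := by
    rw [Finset.nonempty_iff_ne_empty]
    intro h
    exact hPu (Finset.compl_eq_empty_iff P |>.1 h)
  obtain ⟨t', ht', hmin⟩ := Finset.exists_min_image Pᶜ depth hne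
  rw [Finset.mem_compl] at ht'
  have ht'r : t' ≠ r := by rintro rfl; exact ht' hrP
  have hpt' : par t' ∈ P := by
    by_contra h
    exact absurd (hmin _ (Finset.mem_compl.2 h)) (not_le.2 (hdepth t' ht'r))
  obtain ⟨t, htP, htt'⟩ : ∃ t ∈ P, φ t = φ t' := by
    by_contra! hcon
    have : insert t' P ∈ Q := by
      refine Finset.mem_filter.2 ⟨Finset.mem_univ _, Finset.mem_insert_of_mem hrP, ?_, ?_⟩
      · intro s hs hsr
        rcases Finset.mem_insert.1 hs with rfl | hs
        · exact Finset.mem_insert_of_mem hpt'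
        · exact Finset.mem_insert_of_mem (hclosed s hs hsr)
      · rw [Finset.coe_insert, Set.injOn_insert (by simpa using ht')]
        refine ⟨hinj, ?_⟩
        rintro ⟨t, ht, h⟩
        exact hcon t ht h
    have := hmax _ this
    rw [Finset.card_insert_of_notMem ht'] at this
    omega
  let ψ : T → V ⊕ C := fun s => if s ∈ P then φ s else .inl v
  have hψ : ∀ s ∈ P, ψ s = φ s := fun s hs => by simp [ψ, hs]
  have hmem : ∀ e, e ∈ imageEdges r par P ψ →
      ∃ s ∈ P, s ≠ r ∧ Joins e (φ (par s)) (φ s) := by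
    intro e he
    obtain ⟨s, hs, hsr, hj⟩ := (Finset.mem_filter.1 he).2
    rw [hψ s hs, hψ _ (hclosed s hs hsr)] at hj
    exact ⟨s, hs, hsr, hj⟩
  obtain ⟨e, heN, hej⟩ := hadj t' ht'r
  refine hN P (par t') t ⟨ψ, ⟨by rw [hψ r hrP, hr], fun s hs => by simp [ψ, hs], ?_⟩, ?_, e, ?_, ?_,
    heN⟩
  · intro s hs hsr
    obtain ⟨e', _, he'⟩ := hadj s hsr
    exact ⟨e', by rwa [hψ s hs, hψ _ (hclosed s hs hsr)]⟩
  · intro e' he'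
    obtain ⟨s, hs, hsr, hj⟩ := hmem e' he'
    obtain ⟨e'', he'', hj'⟩ := hadj s hsr
    rwa [hj.unique hj']
  -- The edge to `t'` is new. If it were the image of a tree edge with the same orientation, two
  -- siblings would share an image; with the opposite orientation, `t'` would have the image of its
  -- grandparent.
  · intro he
    obtain ⟨s, hs, hsr, hj⟩ := hmem e he
    rw [← htt'] at hej
    rcases hj.eq_or_eq hej with ⟨h1, h2⟩ | ⟨h1, h2⟩
    · have h1' := hinj (hclosed s hs hsr) hpt' h1
      have h2' := hinj hs htP h2
      subst h2'
      exact ht' (hsib s t' hsr ht'r h1' htt' ▸ hs)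
    · have h1' := hinj (hclosed s hs hsr) htP h1
      have h2' := hinj hs hpt' h2
      subst h2'
      exact hgp t' ht'r hsr (by rw [h1', htt'])
  · rw [hψ _ hpt', hψ _ htP, htt']
    exact hej

end Subtrees

/-! ### Short cycles near a node -/

section TreeNodes

variable {dv dc : ℕ}

/-- The nodes of the infinite tree. -/
abbrev TreeNode (dv dc : ℕ) := TreeVar dv dc ⊕ TreeCheck dv dc

/-- The depth of a check node. -/
def TreeCheck.depth : TreeCheck dv dc → ℕ
  | .top _ => 1
  | .deeper c _ _ => c.depth + 2

/-- The depth of a node. -/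
def nodeDepth : TreeNode dv dc → ℕ
  | .inl .root => 0
  | .inl (.child c _) => c.depth + 1
  | .inr c => c.depth

/-- The parent of a node; the root is its own parent. -/
def nodeParent : TreeNode dv dc → TreeNode dv dc
  | .inl .root => .inl .root
  | .inl (.child c _) => .inr c
  | .inr c => .inl c.parent

theorem nodeDepth_parent_lt {s : TreeNode dv dc} (hs : s ≠ .inl .root) :
    nodeDepth (nodeParent s) < nodeDepth s := by
  rcases s with (_ | ⟨c, j⟩) | c
  · exact (hs rfl).elim
  · simp [nodeDepth, nodeParent]
  · cases c <;> simp [nodeDepth, nodeParent, TreeCheck.parent, TreeCheck.depth]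

/-- Every finite set of nodes is contained in a finite subtree. -/
theorem exists_finite_subtree (S : Finset (TreeNode dv dc)) :
    ∃ K : Finset (TreeNode dv dc), S ⊆ K ∧ .inl .root ∈ K ∧ ∀ s ∈ K, nodeParent s ∈ K := by
  classical
  have h1 : ∀ k (s : TreeNode dv dc), nodeDepth s = k →
      ∃ K : Finset (TreeNode dv dc), s ∈ K ∧ ∀ z ∈ K, nodeParent z ∈ K := by
    intro k
    induction k using Nat.strong_induction_on with
    | _ k ih =>
      intro s hs
      by_cases hsr : s = .inl .root
      · exact ⟨{s}, by simp, by simp [hsr, nodeParent]⟩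
      · obtain ⟨K, hK, hK'⟩ := ih _ (hs ▸ nodeDepth_parent_lt hsr) _ rfl
        refine ⟨insert s K, by simp, fun z hz => ?_⟩
        rcases Finset.mem_insert.1 hz with rfl | hz
        · exact Finset.mem_insert_of_mem hK
        · exact Finset.mem_insert_of_mem (hK' z hz)
  choose K hK hK' using fun s => h1 _ s rfl
  refine ⟨(insert (.inl .root) S).biUnion K, fun s hs => Finset.mem_biUnion.2
    ⟨s, Finset.mem_insert_of_mem hs, hK s⟩, Finset.mem_biUnion.2
    ⟨_, Finset.mem_insert_self _ _, hK _⟩, fun z hz => ?_⟩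
  obtain ⟨s, hs, hz⟩ := Finset.mem_biUnion.1 hz
  exact Finset.mem_biUnion.2 ⟨s, hs, hK' s z hz⟩

variable {V C : Type*} {hdv : 0 < dv} {hdc : 0 < dc} {G : BiregularGraph dv dc V C}
  {p : TreeVar dv dc → V} {q : TreeCheck dv dc → C}

theorem child_mem_chkNbrs (hdv : 0 < dv) (hdc : 0 < dc) (c : TreeCheck dv dc) (j : Fin (dc - 1)) :
    .child c j ∈ (biregularTree dv dc hdv hdc).chkNbrs c := by
  simp [biregularTree_chkNbrs]

theorem parent_mem_chkNbrs (hdv : 0 < dv) (hdc : 0 < dc) (c : TreeCheck dv dc) :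
    c.parent ∈ (biregularTree dv dc hdv hdc).chkNbrs c := by
  simp [biregularTree_chkNbrs]

theorem mem_varNbrs_parent (hdv : 0 < dv) (hdc : 0 < dc) (c : TreeCheck dv dc) :
    c ∈ (biregularTree dv dc hdv hdc).varNbrs c.parent :=
  ((biregularTree dv dc hdv hdc).mem_chkNbrs _ _).1 (parent_mem_chkNbrs hdv hdc c)

theorem mem_varNbrs_child (hdv : 0 < dv) (hdc : 0 < dc) (c : TreeCheck dv dc) (j : Fin (dc - 1)) :
    c ∈ (biregularTree dv dc hdv hdc).varNbrs (.child c j) :=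
  ((biregularTree dv dc hdv hdc).mem_chkNbrs _ _).1 (child_mem_chkNbrs hdv hdc c j)

theorem IsCovering.mem_varNbrs (h : IsCovering hdv hdc G p q) {t : TreeVar dv dc}
    {c : TreeCheck dv dc} (htc : c ∈ (biregularTree dv dc hdv hdc).varNbrs t) :
    q c ∈ G.varNbrs (p t) := by
  classical
  rw [h.varNbrs_eq]
  exact Finset.mem_image_of_mem q htc

theorem IsCovering.joins (h : IsCovering hdv hdc G p q) {s : TreeNode dv dc}
    (hs : s ≠ .inl .root) : ∃ e : V × C, e.2 ∈ G.varNbrs e.1 ∧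
      Joins e (Sum.map p q (nodeParent s)) (Sum.map p q s) := by
  rcases s with (_ | ⟨c, j⟩) | c
  · exact (hs rfl).elim
  · exact ⟨(p (.child c j), q c), h.mem_varNbrs (mem_varNbrs_child hdv hdc c j), Or.inr ⟨rfl, rfl⟩⟩
  · exact ⟨(p c.parent, q c), h.mem_varNbrs (mem_varNbrs_parent hdv hdc c), Or.inl ⟨rfl, rfl⟩⟩

theorem IsCovering.eq_of_parent_eq (h : IsCovering hdv hdc G p q) {a b : TreeNode dv dc}
    (ha : a ≠ .inl .root) (hb : b ≠ .inl .root) (hab : nodeParent a = nodeParent b)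
    (hφ : Sum.map p q a = Sum.map p q b) : a = b := by
  rcases a with (_ | ⟨c, j⟩) | c <;> rcases b with (_ | ⟨d, i⟩) | d <;>
    simp only [nodeParent, Sum.map_inl, Sum.map_inr, Sum.inl.injEq, Sum.inr.injEq, reduceCtorEq,
      ne_eq, not_true] at ha hb hab hφ
  · subst hab
    rw [h.injOn_chkNbrs c (child_mem_chkNbrs hdv hdc c j) (child_mem_chkNbrs hdv hdc c i) hφ]
  · rw [h.injOn_varNbrs c.parent (mem_varNbrs_parent hdv hdc c)
      (hab ▸ mem_varNbrs_parent hdv hdc d) hφ]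

/-- A covering does not backtrack: `a` and its grandparent are distinct neighbours of the parent of
`a`, where the covering is injective. -/
theorem IsCovering.grandparent_ne (h : IsCovering hdv hdc G p q) {a : TreeNode dv dc}
    (ha : a ≠ .inl .root) (ha' : nodeParent a ≠ .inl .root) :
    Sum.map p q (nodeParent (nodeParent a)) ≠ Sum.map p q a := by
  intro hφ
  rcases a with (_ | ⟨c, j⟩) | (i | ⟨c, j, i⟩)
  · exact ha rfl
  · simp only [nodeParent, Sum.map_inl, Sum.inl.injEq] at hφ
    exact TreeCheck.child_ne_parent c j (h.injOn_chkNbrs c (child_mem_chkNbrs hdv hdc c j)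
      (parent_mem_chkNbrs hdv hdc c) hφ.symm)
  · exact ha' rfl
  · simp only [nodeParent, TreeCheck.parent, Sum.map_inr, Sum.inr.injEq] at hφ
    exact TreeCheck.deeper_ne c j i (h.injOn_varNbrs (.child c j)
      (mem_varNbrs_parent hdv hdc (.deeper c j i)) (mem_varNbrs_child hdv hdc c j) hφ.symm)

variable [Fintype V] [Fintype C]

/-- Some part of the finite subtree `K` has an image at `v` that is closed by another edge. -/
def ClosesNear (K : Finset (TreeNode dv dc)) (hroot : .inl .root ∈ K)
    (hK : ∀ s ∈ K, nodeParent s ∈ K) (v : V) (N : V → Finset C) : Prop :=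
  ∃ (P : Finset K) (s₀ t : K),
    ClosesAt (⟨.inl .root, hroot⟩ : K) (fun s => ⟨nodeParent s, hK s s.2⟩) v P s₀ t N

theorem IsCovering.injOn_of_not_closesNear (h : IsCovering hdv hdc G p q)
    {K : Finset (TreeNode dv dc)} {hroot : .inl .root ∈ K} {hK : ∀ s ∈ K, nodeParent s ∈ K}
    (hN : ¬ ClosesNear K hroot hK (p .root) G.varNbrs) :
    Set.InjOn (Sum.map p q) (K : Set (TreeNode dv dc)) := by
  classical
  have hne : ∀ s : K, s ≠ ⟨.inl .root, hroot⟩ → s.1 ≠ .inl .root := fun s hs h' =>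
    hs (Subtype.ext h')
  have := injective_of_not_closesAt (T := K) (r := ⟨.inl .root, hroot⟩)
    (par := fun s => ⟨nodeParent s, hK s s.2⟩) (depth := fun s => nodeDepth s.1)
    (fun s hs => nodeDepth_parent_lt (hne s hs)) (v := p .root) (N := G.varNbrs)
    (φ := fun s => Sum.map p q s.1) rfl (fun s hs => h.joins (hne s hs))
    (fun a b ha hb hab hφ => Subtype.ext (h.eq_of_parent_eq (hne a ha) (hne b hb)
      (congrArg Subtype.val hab) hφ))
    (fun a ha ha' => h.grandparent_ne (hne a ha) (hne _ ha'))
    (fun P s₀ t hc => hN ⟨P, s₀, t, hc⟩)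
  intro a ha b hb hab
  exact congrArg Subtype.val (this (a₁ := ⟨a, ha⟩) (a₂ := ⟨b, hb⟩) hab)

/-- The constant in the bound for the probability of short cycles. -/
def closeConst (dv dc k : ℕ) : ℕ := 2 ^ k * k ^ 2 * (2 * dc * (dv + dc) ^ k)

open Classical in
theorem card_closesNear_mul_le [DecidableEq V] [DecidableEq C] (hdv : 0 < dv) (K : Finset (TreeNode dv dc))
    (hroot : .inl .root ∈ K) (hK : ∀ s ∈ K, nodeParent s ∈ K)
    (hn : 2 * (K.card + 2 * (dv * dc)) ≤ Fintype.card V * dv) (v : V) (N₀ : V → Finset C) :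
    ((extensions dv dc Finset.univ N₀).filter (ClosesNear K hroot hK v)).card * Fintype.card V ≤
      closeConst dv dc K.card * (extensions dv dc Finset.univ N₀).card := by
  set X := extensions dv dc Finset.univ N₀ with hX
  -- A union bound over the part `P` and the ends `s₀`, `t` of the closing edge; the number of
  -- triples is the factor `2 ^ k * k ^ 2` of `closeConst`.
  let R : Finset K × K × K → (V → Finset C) → Prop := fun i =>
    ClosesAt (⟨.inl .root, hroot⟩ : K) (fun s => ⟨nodeParent s, hK s s.2⟩) v i.1 i.2.1 i.2.2
  have hsub : X.filter (ClosesNear K hroot hK v) ⊆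
      Finset.univ.biUnion fun i => X.filter (R i) := by
    intro N hN
    obtain ⟨hNX, P, s₀, t, h⟩ := Finset.mem_filter.1 hN
    exact Finset.mem_biUnion.2 ⟨(P, s₀, t), Finset.mem_univ _, Finset.mem_filter.2 ⟨hNX, h⟩⟩
  have hR : ∀ i, (X.filter (R i)).card * Fintype.card V ≤
      2 * dc * (dv + dc) ^ K.card * X.card := by
    intro i
    have := card_closesAt_mul_le (T := K) (r := ⟨.inl .root, hroot⟩) (dv := dv) (dc := dc)
      (par := fun s => ⟨nodeParent s, hK s s.2⟩) (depth := fun s => nodeDepth s.1) hdv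
      (fun s hs => nodeDepth_parent_lt fun h' => hs (Subtype.ext h')) (by simpa using hn) v
      i.1 i.2.1 i.2.2 N₀
    simpa using this
  calc _ ≤ (∑ i, (X.filter (R i)).card) * Fintype.card V :=
        Nat.mul_le_mul_right _ ((Finset.card_le_card hsub).trans Finset.card_biUnion_le)
    _ = ∑ i, (X.filter (R i)).card * Fintype.card V := Finset.sum_mul ..
    _ ≤ ∑ _i : Finset K × K × K, 2 * dc * (dv + dc) ^ K.card * X.card :=
        Finset.sum_le_sum fun i _ => hR i
    _ = _ := by
        rw [Finset.sum_const, smul_eq_mul, Finset.card_univ, Fintype.card_prod, Fintype.card_prod,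
          Fintype.card_finset, Fintype.card_coe, closeConst]
        ring

end TreeNodes

/-! ### The uniform random graph -/

section UniformGraph

variable {dv dc : ℕ} {V C : Type*} [Fintype V] [Fintype C] [DecidableEq V] [DecidableEq C]

theorem BiregularGraph.varNbrs_injective {V C : Type*} :
    Function.Injective (BiregularGraph.varNbrs (dv := dv) (dc := dc) (V := V) (C := C)) := by
  intro G G' h
  refine BiregularGraph.ext h (funext fun c => Finset.ext fun v => ?_)
  rw [G.mem_chkNbrs, G'.mem_chkNbrs, h]

instance BiregularGraph.instFintype : Fintype (BiregularGraph dv dc V C) :=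
  Fintype.ofInjective _ BiregularGraph.varNbrs_injective

theorem BiregularGraph.isBiregular {V C : Type*} [Fintype V] [DecidableEq C] (G : BiregularGraph dv dc V C) :
    IsBiregular dv dc G.varNbrs := by
  refine ⟨G.card_varNbrs, fun c => ?_⟩
  refine (congrArg Finset.card (Finset.ext fun v => ?_)).trans (G.card_chkNbrs c)
  simp [G.mem_chkNbrs]

/-- The graph with a given neighbourhood function. -/
def BiregularGraph.ofVarNbrs {V C : Type*} [Fintype V] [DecidableEq C] (N : V → Finset C) (hN : IsBiregular dv dc N) :
    BiregularGraph dv dc V C where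
  varNbrs := N
  chkNbrs c := Finset.univ.filter fun v => c ∈ N v
  mem_chkNbrs v c := by simp
  card_varNbrs := hN.1
  card_chkNbrs := hN.2

/-- A function of graphs as a function of neighbourhood functions. -/
def onVarNbrs {V C : Type*} [Fintype V] [DecidableEq C]
    (h : BiregularGraph dv dc V C → ℝ) (N : V → Finset C) : ℝ :=
  open Classical in if hN : IsBiregular dv dc N then h (.ofVarNbrs N hN) else 0

theorem onVarNbrs_varNbrs {V C : Type*} [Fintype V] [DecidableEq C]
    (h : BiregularGraph dv dc V C → ℝ) (G : BiregularGraph dv dc V C) :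
    onVarNbrs h G.varNbrs = h G := by
  rw [onVarNbrs, dif_pos G.isBiregular]
  congr 1
  exact BiregularGraph.varNbrs_injective rfl

theorem sum_eq_sum_onVarNbrs (N₀ : V → Finset C) (F : (V → Finset C) → ℝ) :
    ∑ N ∈ extensions dv dc Finset.univ N₀, F N =
      ∑ G : BiregularGraph dv dc V C, F G.varNbrs := by
  symm
  refine Finset.sum_bij (fun G _ => G.varNbrs) (fun G _ => mem_extensions.2 ⟨G.isBiregular, by simp⟩)
    (fun G _ G' _ h => BiregularGraph.varNbrs_injective h) (fun N hN => ?_) (fun G _ => rfl)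
  exact ⟨.ofVarNbrs N (mem_extensions.1 hN).1, Finset.mem_univ _, rfl⟩

theorem card_extensions_univ (N₀ : V → Finset C) :
    ((extensions dv dc Finset.univ N₀).card : ℝ) = Fintype.card (BiregularGraph dv dc V C) := by
  have := sum_eq_sum_onVarNbrs (dv := dv) (dc := dc) N₀ fun _ => 1
  simpa using this

instance BiregularGraph.instDiscrete {V C : Type*} :
    DiscreteMeasurableSpace (BiregularGraph dv dc V C) := ⟨fun _ => trivial⟩

/-- With every node unrevealed, agreement with `N₀` is vacuous, so the counting results on
`extensions` become statements about the uniform law. -/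
theorem integral_uniformGraph [Nonempty (BiregularGraph dv dc V C)] (N₀ : V → Finset C)
    (F : (V → Finset C) → ℝ) :
    ∫ G : BiregularGraph dv dc V C, F G.varNbrs ∂(uniformOn Set.univ) =
      avg (extensions dv dc Finset.univ N₀) F := by
  rw [integral_fintype Integrable.of_finite, avg, sum_eq_sum_onVarNbrs, card_extensions_univ,
    Finset.sum_div]
  refine Finset.sum_congr rfl fun G _ => ?_
  rw [measureReal_def, uniformOn_univ, Measure.count_singleton, smul_eq_mul]
  simp [div_eq_inv_mul]

/-- A function of a uniform biregular graph that is Lipschitz for the number of changed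
neighbourhoods is sub-Gaussian. -/
theorem CenteredMGFBound.uniformGraph [Nonempty (BiregularGraph dv dc V C)] (hdv : 0 < dv)
    {h : BiregularGraph dv dc V C → ℝ} {L : ℝ} (hL : 0 ≤ L)
    (hh : ∀ G G', |h G - h G'| ≤
      L * (Finset.univ.filter fun v => G.varNbrs v ≠ G'.varNbrs v).card) :
    CenteredMGFBound h (Fintype.card V * (revealConst dv dc * L) ^ 2) (uniformOn Set.univ) := by
  obtain ⟨G₀⟩ := ‹Nonempty (BiregularGraph dv dc V C)›
  have : Nonempty (BiregularGraph dv dc V C) := ⟨G₀⟩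
  have hF : HammingLipschitz dv dc L (onVarNbrs h) := by
    intro N N' hN hN'
    have := hh (.ofVarNbrs N hN) (.ofVarNbrs N' hN')
    rw [← onVarNbrs_varNbrs h, ← onVarNbrs_varNbrs h] at this
    exact this
  intro lam
  have hb := avg_exp_extensions_le hdv hL hF lam Finset.univ G₀.varNbrs
    ⟨G₀.varNbrs, mem_extensions.2 ⟨G₀.isBiregular, by simp⟩⟩
  rw [← integral_uniformGraph, ← integral_uniformGraph] at hb
  simp_rw [onVarNbrs_varNbrs] at hb
  refine hb.trans (le_of_eq ?_)
  rw [Finset.card_univ]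
  congr 1; ring

end UniformGraph

/-! ### The random ensemble: variance proxy and mean -/

section Ensemble

variable {dv dc : ℕ} {V C : Type*} [Fintype V] [Fintype C] [DecidableEq V] [DecidableEq C]

theorem sum_weight_sq {V C : Type*} [Fintype V] [Fintype C] [DecidableEq C] (G : BiregularGraph dv dc V C) (a : ℝ) :
    ∑ e : V × C, (a * ((if e.2 ∈ G.varNbrs e.1 then dc else 0 : ℕ) : ℝ)) ^ 2 =
      Fintype.card V * dv * (a * dc) ^ 2 := by
  rw [Fintype.sum_prod_type]
  have : ∀ v, ∑ c, (a * ((if c ∈ G.varNbrs v then dc else 0 : ℕ) : ℝ)) ^ 2 = dv * (a * dc) ^ 2 := by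
    intro v
    rw [← Finset.sum_subset (Finset.subset_univ (G.varNbrs v)) fun c _ hc => by simp [hc],
      Finset.sum_congr rfl fun c hc => by rw [if_pos hc], Finset.sum_const, G.card_varNbrs,
      nsmul_eq_mul]
  simp only [this, Finset.sum_const, nsmul_eq_mul, Finset.card_univ]
  ring

instance dataLaw.instIsProbabilityMeasure {V C : Type*} (f g : Measure ℝ)
    [IsProbabilityMeasure f] [IsProbabilityMeasure g] (α : unitInterval) :
    IsProbabilityMeasure (dataLaw V C f g α) := by
  unfold dataLaw; infer_instance

theorem measurable_unverifiedFraction_data {V C : Type*} [Fintype V] [Fintype C] (hdv : 0 < dv) (alg : VBAlgorithm) (ℓ : ℕ)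
    (G : BiregularGraph dv dc V C) :
    Measurable fun ω : (V × C → ℝ) × (V → ℝ) => unverifiedFraction alg ℓ G ω.1 ω.2 :=
  measurable_unverifiedFraction hdv alg G (fun e => by fun_prop) (fun v => by fun_prop) ℓ

theorem measurable_unverifiedFraction_graph {V C : Type*} [Fintype V] [Fintype C] [DecidableEq V]
    (hdv : 0 < dv) (alg : VBAlgorithm) (ℓ : ℕ) :
    Measurable fun ω : BiregularGraph dv dc V C × ((V × C → ℝ) × (V → ℝ)) =>
      unverifiedFraction alg ℓ ω.1 ω.2.1 ω.2.2 :=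
  measurable_from_prod_countable_right fun G => measurable_unverifiedFraction_data hdv alg ℓ G

/-- The fraction of unverified messages is sub-Gaussian given the graph. -/
theorem CenteredMGFBound.unverifiedFraction_data (hdv : 0 < dv) (alg : VBAlgorithm) (ℓ : ℕ)
    (G : BiregularGraph dv dc V C) (f g : Measure ℝ)
    [IsProbabilityMeasure f] [IsProbabilityMeasure g] (α : unitInterval) :
    CenteredMGFBound (fun ω : (V × C → ℝ) × (V → ℝ) => unverifiedFraction alg ℓ G ω.1 ω.2)
      (Fintype.card V * dv * (spreadConst dv dc ℓ / Fintype.card V * dc) ^ 2 +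
        Fintype.card V * (spreadConst dv dc ℓ / Fintype.card V * ((dv * dc : ℕ) : ℝ)) ^ 2)
      (dataLaw V C f g α) := by
  have hmeas := measurable_unverifiedFraction_data (V := V) (C := C) hdv alg ℓ G
  have hsec : ∀ w : V × C → ℝ, Measurable fun x => unverifiedFraction alg ℓ G w x := fun w =>
    measurable_unverifiedFraction (w := fun _ => w) (x := fun x => x) hdv alg G
      (fun e => measurable_const) (fun v => measurable_pi_apply v) ℓ
  have h01 : ∀ ω : (V × C → ℝ) × (V → ℝ), unverifiedFraction alg ℓ G ω.1 ω.2 ∈ Set.Icc (0 : ℝ) 1 :=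
    fun ω => unverifiedFraction_mem alg ℓ G ω.1 ω.2
  unfold dataLaw
  refine CenteredMGFBound.prod (μ := Measure.infinitePi fun _ : V × C => f)
    (ν := Measure.infinitePi fun _ : V => signalLaw g α) hmeas h01 ?_ ?_
  -- The weights, after integrating out the signal; the signal for fixed weights is the second case.
  · rw [Measure.infinitePi_eq_pi fun _ : V × C => f, ← sum_weight_sq G]
    have hg01 : ∀ w : V × C → ℝ, ∫ x, unverifiedFraction alg ℓ G w x
        ∂(Measure.infinitePi fun _ : V => signalLaw g α) ∈ Set.Icc (0 : ℝ) 1 := fun w =>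
      integral_mem_unitInterval (hsec w) fun x => unverifiedFraction_mem alg ℓ G w x
    have hgm : Measurable fun w : V × C → ℝ => ∫ x, unverifiedFraction alg ℓ G w x
        ∂(Measure.infinitePi fun _ : V => signalLaw g α) := measurable_integral_prod_right hmeas
    refine CenteredMGFBound.pi (c := fun e : V × C => spreadConst dv dc ℓ / Fintype.card V *
      ((if e.2 ∈ G.varNbrs e.1 then dc else 0 : ℕ) : ℝ)) f hgm hg01 fun w e y => ?_
    exact abs_integral_sub_integral_le
      (integrable_of_mem_unitInterval (hsec w) fun _ => unverifiedFraction_mem ..)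
      (integrable_of_mem_unitInterval (hsec _) fun _ => unverifiedFraction_mem ..) fun x =>
      abs_unverifiedFraction_sub_le hdv alg ℓ G w x G _ x
        (card_not_sameAt_update_weight_le G w x e y)
  · intro w
    rw [Measure.infinitePi_eq_pi]
    have := CenteredMGFBound.pi (signalLaw g α) (hsec w)
      (c := fun _ => spreadConst dv dc ℓ / Fintype.card V * ((dv * dc : ℕ) : ℝ))
      (fun _ => unverifiedFraction_mem ..) fun x v y =>
        abs_unverifiedFraction_sub_le hdv alg ℓ G w x G w _
          (card_not_sameAt_update_signal_le G w x v y)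
    simpa using this

/-- The variance proxy, multiplied by the number of variable nodes. -/
def varianceConst (dv dc ℓ : ℕ) : ℝ :=
  (revealConst dv dc * (spreadConst dv dc ℓ * (1 + 2 * (dv * dc)))) ^ 2 +
    (dv * (spreadConst dv dc ℓ * dc) ^ 2 + (spreadConst dv dc ℓ * (dv * dc)) ^ 2) + 1

theorem varianceConst_pos (dv dc ℓ : ℕ) : 0 < varianceConst dv dc ℓ := by
  unfold varianceConst; positivity

/-- Integrated over the data, the fraction is Lipschitz in the graph with constant `L = O(1/n)`, so
revealing `n` neighbourhoods costs `n * O(L ^ 2) = O(1/n)`. The data given the graph cost `O(1/n)`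
as well, and the proxies add. -/
theorem CenteredMGFBound.unverifiedFraction [Nonempty V] [Nonempty (BiregularGraph dv dc V C)]
    (hdv : 0 < dv) (alg : VBAlgorithm) (ℓ : ℕ) (f g : Measure ℝ)
    [IsProbabilityMeasure f] [IsProbabilityMeasure g] (α : unitInterval) :
    CenteredMGFBound (fun ω : BiregularGraph dv dc V C × ((V × C → ℝ) × (V → ℝ)) =>
        _root_.unverifiedFraction alg ℓ ω.1 ω.2.1 ω.2.2)
      (varianceConst dv dc ℓ / Fintype.card V) ((uniformOn Set.univ).prod (dataLaw V C f g α)) := by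
  classical
  have hn : (0 : ℝ) < Fintype.card V := by exact_mod_cast Fintype.card_pos
  have hmeas := measurable_unverifiedFraction_graph (V := V) (C := C) (dc := dc) hdv alg ℓ
  have hint : ∀ G : BiregularGraph dv dc V C,
      Integrable (fun ω => _root_.unverifiedFraction alg ℓ G ω.1 ω.2) (dataLaw V C f g α) := fun G =>
    integrable_of_mem_unitInterval (measurable_unverifiedFraction_data hdv alg ℓ G)
      fun _ => unverifiedFraction_mem ..
  have h := CenteredMGFBound.prod (μ := uniformOn Set.univ) (ν := dataLaw V C f g α) hmeas
    (fun _ => unverifiedFraction_mem ..)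
    (CenteredMGFBound.uniformGraph hdv
      (L := spreadConst dv dc ℓ / Fintype.card V * (1 + 2 * (dv * dc))) (by positivity)
      fun G G' => abs_integral_sub_integral_le (hint G) (hint G') fun ω => by
        have := abs_unverifiedFraction_sub_le hdv alg ℓ G ω.1 ω.2 G' ω.1 ω.2
          (card_not_sameAt_graph_le G G' ω.1 ω.2)
        refine this.trans (le_of_eq ?_)
        push_cast
        rw [mul_assoc])
    (fun G => CenteredMGFBound.unverifiedFraction_data hdv alg ℓ G f g α)
  refine h.mono ?_
  rw [le_div_iff₀ hn, varianceConst]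
  push_cast
  -- The summand 1 of `varianceConst` only ensures positivity.
  refine le_trans (le_of_eq ?_) (le_add_of_nonneg_right zero_le_one)
  field_simp

theorem integral_unverifiedFraction_data {V C : Type*} [Fintype V] [Fintype C] (hdv : 0 < dv) (alg : VBAlgorithm) (ℓ : ℕ)
    (G : BiregularGraph dv dc V C) (f g : Measure ℝ)
    [IsProbabilityMeasure f] [IsProbabilityMeasure g] (α : unitInterval) :
    ∫ ω, unverifiedFraction alg ℓ G ω.1 ω.2 ∂(dataLaw V C f g α) =
      (∑ v, (dataLaw V C f g α).real {ω | (varOut alg G ω.1 ω.2 ℓ v).1 = false}) /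
        Fintype.card V := by
  classical
  have hset : ∀ v, MeasurableSet {ω : (V × C → ℝ) × (V → ℝ) |
      (varOut alg G ω.1 ω.2 ℓ v).1 = false} := fun v =>
    measurableSet_varOut_unverified alg G (fun e => by fun_prop) (fun v => by fun_prop) ℓ v
  simp_rw [unverifiedFraction_eq hdv]
  rw [integral_div]
  congr 1
  have : ∀ ω : (V × C → ℝ) × (V → ℝ),
      ((Finset.univ.filter fun v => (varOut alg G ω.1 ω.2 ℓ v).1 = false).card : ℝ) =
      ∑ v, Set.indicator {ω : (V × C → ℝ) × (V → ℝ) | (varOut alg G ω.1 ω.2 ℓ v).1 = false}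
        (fun _ => (1 : ℝ)) ω := by
    intro ω
    rw [Finset.card_filter]
    push_cast
    exact Finset.sum_congr rfl fun v _ => by simp [Set.indicator_apply]
  simp_rw [this]
  rw [integral_finsetSum _ fun v _ => (integrable_const (1 : ℝ)).indicator (hset v)]
  refine Finset.sum_congr rfl fun v _ => ?_
  rw [integral_indicator_const _ (hset v), smul_eq_mul, mul_one]

/-- The mean fraction of unverified messages is close to its value for the infinite tree. -/
theorem exists_abs_integral_sub_treeUnverified_le (hdv : 0 < dv) (hdc : 0 < dc) (ℓ : ℕ) :
    ∃ η : ℝ, 0 < η ∧ ∀ (V C : Type) [Fintype V] [Fintype C] [DecidableEq V] [DecidableEq C]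
      [Nonempty V] [Nonempty (BiregularGraph dv dc V C)] (alg : VBAlgorithm) (f g : Measure ℝ)
      [IsProbabilityMeasure f] [IsProbabilityMeasure g] (α : unitInterval),
      |∫ ω, unverifiedFraction alg ℓ ω.1 ω.2.1 ω.2.2
          ∂((uniformOn (Set.univ : Set (BiregularGraph dv dc V C))).prod (dataLaw V C f g α)) -
        treeUnverified dv dc hdv hdc alg ℓ f g α| ≤ η / Fintype.card V := by
  classical
  obtain ⟨B, E, hBE⟩ := exists_finset_dependence (biregularTree dv dc hdv hdc) ℓ .root
  obtain ⟨K, hSK, hroot, hK⟩ := exists_finite_subtree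
    (B.image Sum.inl ∪ (E.image fun e => Sum.inl e.1) ∪ E.image fun e => Sum.inr e.2)
  -- The first term bounds the effect of short cycles. The second makes the claim trivial for the
  -- few `n` too small for the switching bound, as both quantities lie in `[0, 1]`. The last gives
  -- positivity.
  refine ⟨closeConst dv dc K.card + (2 * (K.card + 2 * (dv * dc)) : ℕ) + 1, by positivity, ?_⟩
  intro V C _ _ _ _ _ _ alg f g _ _ α
  obtain ⟨G₀⟩ := ‹Nonempty (BiregularGraph dv dc V C)›
  have : Nonempty (BiregularGraph dv dc V C) := ⟨G₀⟩
  have hn : (0 : ℝ) < Fintype.card V := by exact_mod_cast Fintype.card_pos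
  have hmeas := measurable_unverifiedFraction_graph (V := V) (C := C) (dc := dc) hdv alg ℓ
  have hα01 : treeUnverified dv dc hdv hdc alg ℓ f g α ∈ Set.Icc (0 : ℝ) 1 :=
    ⟨measureReal_nonneg, measureReal_le_one⟩
  set τ := treeUnverified dv dc hdv hdc alg ℓ f g α with hτ
  rw [integral_prod _ (integrable_of_mem_unitInterval hmeas fun _ => unverifiedFraction_mem ..)]
  by_cases hsmall : Fintype.card V * dv < 2 * (K.card + 2 * (dv * dc))
  · have h1 := integral_mem_unitInterval
      (μ := (uniformOn (Set.univ : Set (BiregularGraph dv dc V C)))) (measurable_of_finite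
        fun G => ∫ ω, unverifiedFraction alg ℓ G ω.1 ω.2 ∂(dataLaw V C f g α))
      fun G => integral_mem_unitInterval (measurable_unverifiedFraction_data hdv alg ℓ G)
        fun _ => unverifiedFraction_mem ..
    have h2 : (1 : ℝ) ≤ (closeConst dv dc K.card + (2 * (K.card + 2 * (dv * dc)) : ℕ) + 1) /
        Fintype.card V := by
      rw [le_div_iff₀ hn, one_mul]
      have : Fintype.card V ≤ 2 * (K.card + 2 * (dv * dc)) :=
        (Nat.le_mul_of_pos_right _ hdv).trans hsmall.le
      have : (Fintype.card V : ℝ) ≤ (2 * (K.card + 2 * (dv * dc)) : ℕ) := Nat.cast_le.2 this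
      have : (0 : ℝ) ≤ closeConst dv dc K.card := by positivity
      linarith
    refine le_trans ?_ h2
    rw [abs_le]
    constructor <;> linarith [h1.1, h1.2, hα01.1, hα01.2]
  push Not at hsmall
  let X := extensions dv dc Finset.univ G₀.varNbrs
  let bad : V → (V → Finset C) → Prop := fun v => ClosesNear K hroot hK v
  -- A node without a short cycle nearby has exactly the tree probability; at the others the trivial
  -- bound 1 is used.
  have hgood : ∀ (G : BiregularGraph dv dc V C) (v : V),
      |(dataLaw V C f g α).real {ω | (varOut alg G ω.1 ω.2 ℓ v).1 = false} - τ| ≤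
        if bad v G.varNbrs then 1 else 0 := by
    intro G v
    split_ifs with hb
    · have h0 : 0 ≤ (dataLaw V C f g α).real {ω | (varOut alg G ω.1 ω.2 ℓ v).1 = false} :=
        measureReal_nonneg
      have h1 : (dataLaw V C f g α).real {ω | (varOut alg G ω.1 ω.2 ℓ v).1 = false} ≤ 1 :=
        measureReal_le_one
      rw [abs_le]
      constructor <;> linarith [hα01.1, hα01.2]
    · obtain ⟨p, q, hpq, rfl⟩ := exists_isCovering hdv hdc G v
      have hinj := hpq.injOn_of_not_closesNear hb
      have hBK : ∀ u ∈ B, Sum.inl u ∈ K := fun u hu => hSK (by simp [hu])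
      have hEK1 : ∀ e ∈ E, Sum.inl e.1 ∈ K := fun e he => hSK (by
        simp only [Finset.mem_union, Finset.mem_image]
        exact Or.inl (Or.inr ⟨e, he, rfl⟩))
      have hEK2 : ∀ e ∈ E, Sum.inr e.2 ∈ K := fun e he => hSK (by
        simp only [Finset.mem_union, Finset.mem_image]
        exact Or.inr ⟨e, he, rfl⟩)
      rw [hpq.measureReal_unverified_eq (hBE alg) ?_ ?_ f g α, ← hτ, sub_self, abs_zero]
      · intro u hu u' hu' h
        have := hinj (hBK u hu) (hBK u' hu') (by simp [h])
        simpa using this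
      · intro e he e' he' h
        simp only [Prod.mk.injEq] at h
        have h1 := hinj (hEK1 e he) (hEK1 e' he') (by simp [h.1])
        have h2 := hinj (hEK2 e he) (hEK2 e' he') (by simp [h.2])
        exact Prod.ext (by simpa using h1) (by simpa using h2)
  have hG : ∀ G : BiregularGraph dv dc V C,
      |∫ ω, unverifiedFraction alg ℓ G ω.1 ω.2 ∂(dataLaw V C f g α) - τ| ≤
        (∑ v, if bad v G.varNbrs then (1 : ℝ) else 0) / Fintype.card V := by
    intro G
    have hτ' : τ = (∑ _v : V, τ) / Fintype.card V := by
      rw [Finset.sum_const, Finset.card_univ, nsmul_eq_mul, mul_div_cancel_left₀ _ hn.ne']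
    rw [integral_unverifiedFraction_data hdv]
    conv_lhs => rw [hτ']
    rw [← sub_div, ← Finset.sum_sub_distrib, abs_div, abs_of_pos hn]
    gcongr
    exact (Finset.abs_sum_le_sum_abs _ _).trans (Finset.sum_le_sum fun v _ => hgood G v)
  have hX : (0 : ℝ) < X.card := by
    exact_mod_cast Finset.card_pos.2 ⟨G₀.varNbrs, mem_extensions.2 ⟨G₀.isBiregular, by simp⟩⟩
  calc |∫ G, ∫ ω, unverifiedFraction alg ℓ G ω.1 ω.2 ∂(dataLaw V C f g α) ∂(uniformOn Set.univ) - τ|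
      = |∫ G, (∫ ω, unverifiedFraction alg ℓ G ω.1 ω.2 ∂(dataLaw V C f g α) - τ)
          ∂(uniformOn (Set.univ : Set (BiregularGraph dv dc V C)))| := by
        rw [integral_sub Integrable.of_finite (integrable_const _)]
        simp
    _ ≤ ∫ G, |∫ ω, unverifiedFraction alg ℓ G ω.1 ω.2 ∂(dataLaw V C f g α) - τ|
          ∂(uniformOn (Set.univ : Set (BiregularGraph dv dc V C))) := abs_integral_le_integral_abs
    _ ≤ ∫ G : BiregularGraph dv dc V C, (∑ v, if bad v G.varNbrs then (1 : ℝ) else 0) /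
          Fintype.card V ∂(uniformOn Set.univ) :=
        integral_mono Integrable.of_finite Integrable.of_finite hG
    _ = avg X fun N => (∑ v, if bad v N then (1 : ℝ) else 0) / Fintype.card V :=
        integral_uniformGraph G₀.varNbrs fun N =>
          (∑ v, if bad v N then (1 : ℝ) else 0) / Fintype.card V
    _ = (∑ v, ((X.filter (bad v)).card : ℝ)) / Fintype.card V / X.card := by
        rw [avg, ← Finset.sum_div, Finset.sum_comm]
        simp only [Finset.sum_boole]
    _ ≤ (∑ _v : V, (closeConst dv dc K.card * X.card / Fintype.card V : ℝ)) /
          Fintype.card V / X.card := by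
        gcongr with v
        rw [le_div_iff₀ hn]
        have := card_closesNear_mul_le hdv K hroot hK hsmall v G₀.varNbrs
        exact_mod_cast this
    _ = closeConst dv dc K.card / Fintype.card V := by
        rw [Finset.sum_const, Finset.card_univ, nsmul_eq_mul]
        field_simp
    _ ≤ _ := by
        gcongr
        have : (0 : ℝ) ≤ (2 * (K.card + 2 * (dv * dc)) : ℕ) := by positivity
        linarith

end Ensemble

end

theorem theorem1 (dv dc ℓ : ℕ) (hdv : 0 < dv) (hdc : 0 < dc) :
    ∃ μ η : ℝ, 0 < μ ∧ 0 < η ∧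
      ∀ (alg : VBAlgorithm) (f g : Measure ℝ) [IsProbabilityMeasure f] [IsProbabilityMeasure g]
        (α : unitInterval) (n m : ℕ), m * dc = n * dv →
        Nonempty (BiregularGraph dv dc (Fin n) (Fin m)) →
        Integrable (fun ω => unverifiedFraction alg ℓ ω.1 ω.2.1 ω.2.2)
          (ensembleLaw dv dc n m f g α) ∧
        (∀ ε : ℝ, 0 < ε →
          (ensembleLaw dv dc n m f g α).real
            {ω | |unverifiedFraction alg ℓ ω.1 ω.2.1 ω.2.2 -
                ∫ ω', unverifiedFraction alg ℓ ω'.1 ω'.2.1 ω'.2.2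
                  ∂(ensembleLaw dv dc n m f g α)| > ε / 2}
            ≤ 2 * Real.exp (-(ε ^ 2 * n / μ))) ∧
        (∀ ε : ℝ, 0 < ε → (n : ℝ) > 2 * η / ε →
          |∫ ω, unverifiedFraction alg ℓ ω.1 ω.2.1 ω.2.2 ∂(ensembleLaw dv dc n m f g α) -
              treeUnverified dv dc hdv hdc alg ℓ f g α| < ε / 2) := by
  obtain ⟨η, hη, hmean⟩ := exists_abs_integral_sub_treeUnverified_le hdv hdc ℓ
  have hK := varianceConst_pos dv dc ℓ
  -- The Chernoff exponent `t ^ 2 / (2 * v)` with `t = ε / 2` and `v = varianceConst / n` is `ε ^ 2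
  -- * n / (8 * varianceConst)`.
  refine ⟨8 * varianceConst dv dc ℓ, η, by positivity, hη, ?_⟩
  intro alg f g _ _ α n m _ hne
  have hprob : IsProbabilityMeasure (ensembleLaw dv dc n m f g α) := by
    unfold ensembleLaw; infer_instance
  have hmeas := measurable_unverifiedFraction_graph (V := Fin n) (C := Fin m) (dc := dc) hdv alg ℓ
  refine ⟨integrable_of_mem_unitInterval hmeas fun _ => unverifiedFraction_mem .., ?_, ?_⟩
  · intro ε hε
    -- For `n = 0` the right side is 2, which bounds any probability.
    rcases Nat.eq_zero_or_pos n with rfl | hn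
    · refine measureReal_le_one.trans ?_
      simp
    · have : Nonempty (Fin n) := ⟨⟨0, hn⟩⟩
      have hn' : (0 : ℝ) < n := by exact_mod_cast hn
      have h := (CenteredMGFBound.unverifiedFraction (V := Fin n) (C := Fin m) (dc := dc) hdv alg ℓ
        f g α).measureReal_le hmeas (fun _ => unverifiedFraction_mem ..)
        (by positivity) (half_pos hε).le
      refine h.trans (le_of_eq ?_)
      rw [Fintype.card_fin]
      congr 2
      field_simp
      ring
  · intro ε hε hn
    have hn' : (0 : ℝ) < n := lt_trans (by positivity) hn
    have : Nonempty (Fin n) := ⟨⟨0, by exact_mod_cast hn'⟩⟩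
    refine (hmean (Fin n) (Fin m) alg f g α).trans_lt ?_
    rw [Fintype.card_fin, div_lt_iff₀ hn']
    rw [gt_iff_lt, div_lt_iff₀ hε] at hn
    linarith
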